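/- Fix the standard coordinates on $\mathbb R^3$, identify vector fields with their component columns, and let $\tilde\nabla_{\mathbf r}\mathbf s=\mathbf r(\mathbf s)$ (componentwise derivative of $\mathbf s$ along $\mathbf r$) be the flat connection. Let $\bar u\in\mathbb R^3$. For smooth vector fields $\mathfrak R=\{\mathbf r_1,\mathbf r_2\}$ near $\bar u$, let $\mathcal F(\mathfrak R)$ be the real vector space of smooth maps $F$ from an open neighborhood of $\bar u$ to $\mathbb R^3$ (two maps that agree near $\bar u$ being identified) for which there are smooth functions $\lambda^1,\lambda^2$ with $\tilde\nabla_{\mathbf r_i}F=\lambda^i\mathbf r_i$, $i=1,2$, on a neighborhood of $\bar u$, and let $\mathcal F^{\mathrm{triv}}\subset\mathcal F(\mathfrak R)$ be the subspace of the maps $F(u)=\bar\lambda u+\bar a$ with $\bar\lambda\in\mathbb R$ and $\bar a\in\mathbb R^3$ constant. Consider the following assumptions: $\mathbf r_1,\mathbf r_2$ are smooth on an open neighborhood of $\bar u$ and linearly independent at each of its points; at $\bar u$ none of the vectors $[\mathbf r_1,\mathbf r_2]$, $\tilde\nabla_{\mathbf r_1}\mathbf r_2$, $\tilde\nabla_{\mathbf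 r_2}\mathbf r_1$ lies in $\operatorname{span}_{\mathbb R}\{\mathbf r_1|_{\bar u},\mathbf r_2|_{\bar u}\}$; and, for a smooth vector field $\mathbf s$ completing $\mathbf r_1,\mathbf r_2$ to a local frame $(\mathbf r_1,\mathbf r_2,\mathbf r_3=\mathbf s)$ near $\bar u$, with Christoffel symbols defined by $\tilde\nabla_{\mathbf r_i}\mathbf r_j=\sum_{k=1}^3\Gamma^k_{ij}\mathbf r_k$, $$\Gamma^3_{22}(\bar u)\,\Gamma^3_{11}(\bar u)-9\,\Gamma^3_{12}(\bar u)\,\Gamma^3_{21}(\bar u)\neq 0.$$ Then: 1) whenever these assumptions hold, $0\le\dim\mathcal F(\mathfrak R)/\mathcal F^{\mathrm{triv}}\le 4$; 2) for each $k=0,1,2,3,4$ there are $\mathfrak R$ (and $\mathbf s$) satisfying these assumptions at $\bar u$ with $\dim\mathcal F(\mathfrak R)/\mathcal F^{\mathrm{triv}}=k$. -/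

import Mathlib

namespace FluxGeometry

open scoped ContDiff Topology

/-- A vector field on (part of) `ℝⁿ`, given by its column of components in the fixed affine
coordinates `u¹, …, uⁿ`.  Only its values near the points under consideration matter. -/
abbrev VField (n : ℕ) : Type := (Fin n → ℝ) → (Fin n → ℝ)

/-- The flat symmetric connection whose Christoffel symbols vanish in the affine coordinates:
`∇_r s` has the components `r(s¹), …, r(sⁿ)`, i.e. it is the derivative of `s` along `r`. -/
noncomputable def nabla {n : ℕ} (r s : VField n) : VField n :=
  fun u => fderiv ℝ s u (r u)

/-- `R₁, …, R_m` is a partial frame on `Ω`: smooth on `Ω` and independent at every point. -/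
structure IsPartialFrame {m n : ℕ} (Ω : Set (Fin n → ℝ)) (R : Fin m → VField n) : Prop where
  smooth : ∀ i, ContDiffOn ℝ ∞ (R i) Ω
  independent : ∀ u ∈ Ω, LinearIndependent ℝ (fun i => R i u)

/-- `R₁, …, R_m` is a partial frame on some open neighborhood of `ubar`
(a local frame near `ubar` when `m = n`). -/
def IsPartialFrameNear {m n : ℕ} (ubar : Fin n → ℝ) (R : Fin m → VField n) : Prop :=
  ∃ Ω : Set (Fin n → ℝ), IsOpen Ω ∧ ubar ∈ Ω ∧ IsPartialFrame Ω R

/-- The Christoffel symbol `Γ^k_{ij}` of the connection `nabla` relative to a frame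
`S₁, …, S_n`, at the point `u`: the `k`-th component of `∇_{S_i} S_j` in the frame.  The matrix
that is inverted has the vectors `S₁(u), …, S_n(u)` as its columns. -/
noncomputable def christoffel {n : ℕ} (S : Fin n → VField n) (k i j : Fin n)
    (u : Fin n → ℝ) : ℝ :=
  ((Matrix.of fun a b => S b u a)⁻¹.mulVec (nabla (S i) (S j) u)) k

/-- The defining property `∇_{S_i} S_j = ∑ₖ Γ^k_{ij} S_k` of the Christoffel symbols. -/
theorem nabla_eq_sum_christoffel {n : ℕ} {Ω : Set (Fin n → ℝ)} {S : Fin n → VField n}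
    (hS : IsPartialFrame Ω S) {u : Fin n → ℝ} (hu : u ∈ Ω) (i j : Fin n) :
    nabla (S i) (S j) u = ∑ k, christoffel S k i j u • S k u := by
  have hunit : IsUnit (Matrix.of fun a b => S b u a : Matrix (Fin n) (Fin n) ℝ) := by
    rw [← Matrix.linearIndependent_cols_iff_isUnit]
    exact hS.independent u hu
  have hdet := (Matrix.isUnit_iff_isUnit_det _).1 hunit
  have h : (Matrix.of fun a b => S b u a : Matrix (Fin n) (Fin n) ℝ).mulVec
      (fun k => christoffel S k i j u) = nabla (S i) (S j) u := by
    change Matrix.mulVec _ (Matrix.mulVec _ _) = _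
    rw [Matrix.mulVec_mulVec, Matrix.mul_nonsing_inv _ hdet, Matrix.one_mulVec]
  rw [← h]
  funext a
  simp [Matrix.mulVec, dotProduct, mul_comm]

/-- `F` is a flux for `R₁, …, R_m` on `Ω'`: it is smooth there and `∇_{R_i} F = λ^i R_i` for
some smooth functions `λ^i`; that is, each `R_i` is a right eigenvector of the Jacobian matrix
of `F` throughout `Ω'`. -/
def IsFluxOn {m n : ℕ} (R : Fin m → VField n) (Ω' : Set (Fin n → ℝ)) (F : VField n) : Prop :=
  ContDiffOn ℝ ∞ F Ω' ∧ ∃ lam : Fin m → (Fin n → ℝ) → ℝ,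
    (∀ i, ContDiffOn ℝ ∞ (lam i) Ω') ∧
      ∀ i, ∀ u ∈ Ω', nabla (R i) F u = lam i u • R i u

/-- The flux space `𝓕(R)` at `ubar`: the real vector space of fluxes defined on some open
neighborhood of `ubar`, two of them being identified when they agree near `ubar`
(so that sums are formed on the intersection of the domains). -/
noncomputable def fluxSpace {m n : ℕ} (R : Fin m → VField n) (ubar : Fin n → ℝ) :
    Submodule ℝ (Filter.Germ (𝓝 ubar) (Fin n → ℝ)) where
  carrier := {φ | ∃ (F : VField n) (Ω' : Set (Fin n → ℝ)),
    IsOpen Ω' ∧ ubar ∈ Ω' ∧ IsFluxOn R Ω' F ∧ φ = (F : Filter.Germ (𝓝 ubar) (Fin n → ℝ))}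
  zero_mem' := by
    refine ⟨0, Set.univ, isOpen_univ, Set.mem_univ _, ⟨contDiffOn_const, fun _ => 0, ?_, ?_⟩, rfl⟩
    · intro i
      exact contDiffOn_const
    · intro i u _
      simp [nabla]
  add_mem' := by
    rintro _ _ ⟨F, A, hA, huA, ⟨hF, a, ha, hFa⟩, rfl⟩ ⟨G, B, hB, huB, ⟨hG, b, hb, hGb⟩, rfl⟩
    refine ⟨F + G, A ∩ B, hA.inter hB, ⟨huA, huB⟩,
      ⟨(hF.mono Set.inter_subset_left).add (hG.mono Set.inter_subset_right),
        fun i => a i + b i, fun i => ((ha i).mono Set.inter_subset_left).add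
          ((hb i).mono Set.inter_subset_right), ?_⟩, rfl⟩
    rintro i u ⟨hu, hu'⟩
    have h1 : DifferentiableAt ℝ F u :=
      (hF.contDiffAt (hA.mem_nhds hu)).differentiableAt (by simp)
    have h2 : DifferentiableAt ℝ G u :=
      (hG.contDiffAt (hB.mem_nhds hu')).differentiableAt (by simp)
    have e1 := hFa i u hu
    have e2 := hGb i u hu'
    simp only [nabla] at e1 e2 ⊢
    rw [fderiv_add h1 h2, add_apply, e1, e2, Pi.add_apply, add_smul]
  smul_mem' := by
    rintro c _ ⟨F, A, hA, huA, ⟨hF, a, ha, hFa⟩, rfl⟩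
    refine ⟨c • F, A, hA, huA, ⟨contDiffOn_const.smul hF, fun i => c • a i,
      fun i => contDiffOn_const.smul (ha i), ?_⟩, rfl⟩
    intro i u hu
    have h1 : DifferentiableAt ℝ F u :=
      (hF.contDiffAt (hA.mem_nhds hu)).differentiableAt (by simp)
    have e1 := hFa i u hu
    simp only [nabla] at e1 ⊢
    rw [fderiv_const_smul h1, smul_apply, e1, Pi.smul_apply, smul_assoc]

/-- The space of trivial fluxes `F(u) = c u + a`, with a constant `c ∈ ℝ` and a constant
vector `a ∈ ℝⁿ`, as germs at `ubar`. -/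
noncomputable def trivialFluxes {n : ℕ} (ubar : Fin n → ℝ) :
    Submodule ℝ (Filter.Germ (𝓝 ubar) (Fin n → ℝ)) where
  carrier := {φ | ∃ (c : ℝ) (a : Fin n → ℝ),
    φ = ((fun u => c • u + a : VField n) : Filter.Germ (𝓝 ubar) (Fin n → ℝ))}
  zero_mem' := ⟨0, 0, by simp only [zero_smul, add_zero]; rfl⟩
  add_mem' := by
    rintro _ _ ⟨c, a, rfl⟩ ⟨d, b, rfl⟩
    refine ⟨c + d, a + b, ?_⟩
    rw [← Filter.Germ.coe_add]
    congr 1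
    funext u
    simp only [Pi.add_apply]
    module
  smul_mem' := by
    rintro t _ ⟨c, a, rfl⟩
    refine ⟨t * c, t • a, ?_⟩
    rw [← Filter.Germ.coe_smul]
    congr 1
    funext u
    simp only [Pi.smul_apply]
    module

/-- Trivial fluxes are fluxes for every partial frame. -/
theorem trivialFluxes_le_fluxSpace {m n : ℕ} (R : Fin m → VField n) (ubar : Fin n → ℝ) :
    trivialFluxes ubar ≤ fluxSpace R ubar := by
  rintro _ ⟨c, a, rfl⟩
  refine ⟨_, Set.univ, isOpen_univ, Set.mem_univ _, ⟨?_, fun _ _ => c, ?_, ?_⟩, rfl⟩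
  · exact (((contDiff_const (c := c)).smul (contDiff_id (𝕜 := ℝ) (E := Fin n → ℝ))).add
      contDiff_const).contDiffOn
  · intro i
    exact contDiffOn_const
  · intro i u _
    have h : HasFDerivAt (fun u : Fin n → ℝ => c • u + a)
        (c • ContinuousLinearMap.id ℝ (Fin n → ℝ)) u :=
      ((hasFDerivAt_id u).const_smul c).add_const a
    simp only [nabla]
    rw [h.fderiv]
    simp

/-- The quotient `𝓕(R) / 𝓕^triv` of the flux space by the subspace of trivial fluxes. -/
abbrev FluxQuotient {m n : ℕ} (R : Fin m → VField n) (ubar : Fin n → ℝ) : Type :=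
  (fluxSpace R ubar) ⧸ (trivialFluxes ubar).submoduleOf (fluxSpace R ubar)

/-- The assumptions on a pair of vector fields `r₁ = R 0`, `r₂ = R 1` near `ubar ∈ ℝ³` and on a
vector field `s` that completes it to a local frame. -/
structure SizeHypotheses (ubar : Fin 3 → ℝ) (R : Fin 2 → VField 3) (s : VField 3) : Prop where
  /-- `{r₁, r₂}` is a partial frame on an open neighborhood of `ubar`. -/
  partialFrame : IsPartialFrameNear ubar R
  /-- Non-involutivity: `[r₁, r₂]` at `ubar` is not in the span of `r₁(ubar)`, `r₂(ubar)`. -/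
  nonInvolutive : VectorField.lieBracket ℝ (R 0) (R 1) ubar ∉
    Submodule.span ℝ {R 0 ubar, R 1 ubar}
  /-- `∇_{r₁} r₂` at `ubar` is not in the span of `r₁(ubar)`, `r₂(ubar)`. -/
  nabla_zero_one : nabla (R 0) (R 1) ubar ∉ Submodule.span ℝ {R 0 ubar, R 1 ubar}
  /-- `∇_{r₂} r₁` at `ubar` is not in the span of `r₁(ubar)`, `r₂(ubar)`. -/
  nabla_one_zero : nabla (R 1) (R 0) ubar ∉ Submodule.span ℝ {R 0 ubar, R 1 ubar}
  /-- `{r₁, r₂, s}` is a local frame near `ubar`. -/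
  completion : IsPartialFrameNear ubar ![R 0, R 1, s]
  /-- `Γ³₂₂ Γ³₁₁ - 9 Γ³₁₂ Γ³₂₁ ≠ 0` at `ubar`, relative to the frame `{r₁, r₂, s}`
  (the indices `1, 2, 3` are `0, 1, 2` here). -/
  gamma_ne : christoffel ![R 0, R 1, s] 2 1 1 ubar * christoffel ![R 0, R 1, s] 2 0 0 ubar
    - 9 * christoffel ![R 0, R 1, s] 2 0 1 ubar * christoffel ![R 0, R 1, s] 2 1 0 ubar ≠ 0

end FluxGeometry

/-!
All objects are taken as germs at the base point: smooth functions near `x` form a ring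
`SmoothGerm x`, vector fields act on it by derivations, and a flux for `r₁, r₂` is a triple `F` of
germs with `r_i(F) = λⁱ r_i`.

**Upper bound.** Complete `r₁, r₂` to the frame `r₁, r₂, [r₁, r₂]` and apply the commutation
relations of the derivations along the frame to `F`. The resulting equations
(`BracketFrame.flux_equations`) and their derivatives show that the ideal generated by
`λ¹, λ², r₂(λ¹), r₁(λ²), r₁(r₂(λ¹))` is stable under all derivations
(`BracketFrame.d_mem_span`); the conditions on the Christoffel symbols say that the linear systems
solved on the way have invertible coefficients, and the number
`Γ³₂₂ Γ³₁₁ - 9 Γ³₁₂ Γ³₂₁` is, up to sign, the determinant of the last one, for the derivatives of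
`r₁(r₂(λ¹))`.
So these five germs solve a homogeneous total linear differential system, and they vanish if they
vanish at `x` (`SmoothGerm.eq_zero_of_pd_mem_span`, by Grönwall's inequality along rays).
Subtracting a multiple of the identity map normalizes `λ¹(x) = 0`; hence a flux is determined
modulo trivial ones by the four numbers `λ² - λ¹, r₂(λ¹), r₁(λ²), r₁(r₂(λ¹))` at `x`, its jet
(`fluxJet`). As the eigenvalues of a flux germ are not part of the data, the count of dimensions is
made with a linear relation in place of a linear map (`rank_quotient_le_of_relation`).

**Examples.** The fields `(1, 0, a)` and `(0, 1, b)`, where `a` and `b` depend on the first two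
coordinates only and `∂₁ b = ∂₂ a + 1`, have the third coordinate field as their bracket, which
commutes with both. The equations of a flux then are short (`CentralFlux`), and the
hypotheses become conditions on first derivatives of `a` and `b` at `x`. For each `k ≤ 4` there is
a choice of `a` and `b` such that `k` of the components of the jet are attained arbitrarily, by
explicit fluxes, whereas further derivatives of the equations, evaluated at `x`, express the other
components by them (`CentralFlux.three_constraints` and its companions for fewer parameters).
-/

namespace FluxGeometry

open scoped ContDiff Topology
open Filter

/-! ### Rings of germs of smooth functions -/

/-- The ring of germs at `x` of real functions that are smooth on a neighborhood of `x`. -/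
def smoothGerms {n : ℕ} (x : Fin n → ℝ) : Subring (Germ (𝓝 x) ℝ) where
  carrier := {φ | ∃ f : (Fin n → ℝ) → ℝ, (∀ᶠ u in 𝓝 x, ContDiffAt ℝ ∞ f u) ∧
    φ = (f : Germ (𝓝 x) ℝ)}
  zero_mem' := ⟨fun _ => 0, Eventually.of_forall fun _ => contDiffAt_const, rfl⟩
  one_mem' := ⟨fun _ => 1, Eventually.of_forall fun _ => contDiffAt_const, rfl⟩
  add_mem' := by
    rintro _ _ ⟨f, hf, rfl⟩ ⟨g, hg, rfl⟩
    exact ⟨f + g, by filter_upwards [hf, hg] with u h1 h2 using h1.add h2, rfl⟩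
  mul_mem' := by
    rintro _ _ ⟨f, hf, rfl⟩ ⟨g, hg, rfl⟩
    exact ⟨f * g, by filter_upwards [hf, hg] with u h1 h2 using h1.mul h2, rfl⟩
  neg_mem' := by
    rintro _ ⟨f, hf, rfl⟩
    exact ⟨-f, by filter_upwards [hf] with u h1 using h1.neg, rfl⟩

/-- The type of germs at `x` of smooth real functions. -/
abbrev SmoothGerm {n : ℕ} (x : Fin n → ℝ) : Type := smoothGerms x

namespace SmoothGerm

variable {n : ℕ} {x : Fin n → ℝ}

/-- The germ of a function that is smooth near `x`. -/
def mk (f : (Fin n → ℝ) → ℝ) (hf : ∀ᶠ u in 𝓝 x, ContDiffAt ℝ ∞ f u) : SmoothGerm x :=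
  ⟨(f : Germ (𝓝 x) ℝ), f, hf, rfl⟩

theorem exists_eq_mk (φ : SmoothGerm x) : ∃ f hf, φ = mk (x := x) f hf := by
  obtain ⟨_, f, hf, rfl⟩ := φ
  exact ⟨f, hf, rfl⟩

theorem mk_eq_mk {f g : (Fin n → ℝ) → ℝ} {hf : ∀ᶠ u in 𝓝 x, ContDiffAt ℝ ∞ f u}
    {hg : ∀ᶠ u in 𝓝 x, ContDiffAt ℝ ∞ g u} : mk f hf = mk g hg ↔ f =ᶠ[𝓝 x] g :=
  Subtype.ext_iff.trans Germ.coe_eq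

/-- The value of a germ at the base point. -/
def ev (x : Fin n → ℝ) : SmoothGerm x →+* ℝ := Germ.valueRingHom.comp (smoothGerms x).subtype

@[simp] theorem ev_mk (f : (Fin n → ℝ) → ℝ) (hf : ∀ᶠ u in 𝓝 x, ContDiffAt ℝ ∞ f u) :
    ev x (mk f hf) = f x := rfl

/-- The ring homomorphism that sends a real number to the germ of the constant function. -/
def const (x : Fin n → ℝ) : ℝ →+* SmoothGerm x where
  toFun c := mk (fun _ => c) (Eventually.of_forall fun _ => contDiffAt_const)
  map_one' := rfl
  map_mul' _ _ := rfl
  map_zero' := rfl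
  map_add' _ _ := rfl

@[simp] theorem ev_const (c : ℝ) : ev x (const x c) = c := rfl

theorem isUnit_of_ev_ne_zero {φ : SmoothGerm x} (h : ev x φ ≠ 0) : IsUnit φ := by
  obtain ⟨f, hf, rfl⟩ := exists_eq_mk φ
  have h0 : ∀ᶠ u in 𝓝 x, f u ≠ 0 :=
    hf.self_of_nhds.continuousAt.eventually_ne h
  refine IsUnit.of_mul_eq_one (mk (fun u => (f u)⁻¹) ?_) (Subtype.ext (Germ.coe_eq.2 ?_))
  · filter_upwards [hf, h0] with u h1 h2 using h1.inv h2
  · filter_upwards [h0] with u h2 using mul_inv_cancel₀ h2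

theorem eventually_contDiffAt_fderiv {f : (Fin n → ℝ) → ℝ}
    (hf : ∀ᶠ u in 𝓝 x, ContDiffAt ℝ ∞ f u) (v : Fin n → ℝ) :
    ∀ᶠ u in 𝓝 x, ContDiffAt ℝ ∞ (fun u => fderiv ℝ f u v) u := by
  filter_upwards [hf] with u h
  exact (h.fderiv_right (m := ∞) (by simp)).clm_apply contDiffAt_const

/-- A representative of a germ. -/
noncomputable def rep (φ : SmoothGerm x) : (Fin n → ℝ) → ℝ := φ.2.choose

theorem rep_smooth (φ : SmoothGerm x) : ∀ᶠ u in 𝓝 x, ContDiffAt ℝ ∞ (rep φ) u :=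
  φ.2.choose_spec.1

theorem mk_rep (φ : SmoothGerm x) : mk (rep φ) (rep_smooth φ) = φ :=
  Subtype.ext φ.2.choose_spec.2.symm

theorem rep_mk {f : (Fin n → ℝ) → ℝ} (hf : ∀ᶠ u in 𝓝 x, ContDiffAt ℝ ∞ f u) :
    rep (mk f hf) =ᶠ[𝓝 x] f :=
  mk_eq_mk.1 (mk_rep (mk f hf))

/-- The derivative of a germ in the constant direction `v`. -/
noncomputable def dirDeriv (v : Fin n → ℝ) (φ : SmoothGerm x) : SmoothGerm x :=
  mk (fun u => fderiv ℝ (rep φ) u v) (eventually_contDiffAt_fderiv (rep_smooth φ) v)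

theorem dirDeriv_mk (v : Fin n → ℝ) {f : (Fin n → ℝ) → ℝ}
    (hf : ∀ᶠ u in 𝓝 x, ContDiffAt ℝ ∞ f u) :
    dirDeriv v (mk f hf) = mk (fun u => fderiv ℝ f u v) (eventually_contDiffAt_fderiv hf v) := by
  refine mk_eq_mk.2 ?_
  filter_upwards [(rep_mk hf).fderiv (𝕜 := ℝ)] with u hu
  rw [hu]

theorem dirDeriv_mul (v : Fin n → ℝ) (φ ψ : SmoothGerm x) :
    dirDeriv v (φ * ψ) = φ * dirDeriv v ψ + ψ * dirDeriv v φ := by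
  obtain ⟨f, hf, rfl⟩ := exists_eq_mk φ
  obtain ⟨g, hg, rfl⟩ := exists_eq_mk ψ
  have hfg : ∀ᶠ u in 𝓝 x, ContDiffAt ℝ ∞ (f * g) u := by
    filter_upwards [hf, hg] with u h1 h2 using h1.mul h2
  change dirDeriv v (mk (f * g) hfg) = _
  rw [dirDeriv_mk, dirDeriv_mk, dirDeriv_mk]
  refine Subtype.ext (Germ.coe_eq.2 ?_)
  filter_upwards [hf, hg] with u h1 h2
  rw [fderiv_mul (h1.differentiableAt (by simp)) (h2.differentiableAt (by simp))]
  simp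

theorem dirDeriv_add (v : Fin n → ℝ) (φ ψ : SmoothGerm x) :
    dirDeriv v (φ + ψ) = dirDeriv v φ + dirDeriv v ψ := by
  obtain ⟨f, hf, rfl⟩ := exists_eq_mk φ
  obtain ⟨g, hg, rfl⟩ := exists_eq_mk ψ
  have hfg : ∀ᶠ u in 𝓝 x, ContDiffAt ℝ ∞ (f + g) u := by
    filter_upwards [hf, hg] with u h1 h2 using h1.add h2
  change dirDeriv v (mk (f + g) hfg) = _
  rw [dirDeriv_mk, dirDeriv_mk, dirDeriv_mk]
  refine Subtype.ext (Germ.coe_eq.2 ?_)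
  filter_upwards [hf, hg] with u h1 h2
  rw [fderiv_add (h1.differentiableAt (by simp)) (h2.differentiableAt (by simp))]
  simp

/-- The partial derivative `∂/∂uᵏ`, as a derivation of the ring of smooth germs. -/
noncomputable def pd (x : Fin n → ℝ) (k : Fin n) : Derivation ℤ (SmoothGerm x) (SmoothGerm x) :=
  Derivation.mk' (AddMonoidHom.toIntLinearMap
    (AddMonoidHom.mk' (dirDeriv (Pi.single k 1)) (dirDeriv_add _))) (dirDeriv_mul _)

theorem pd_mk (k : Fin n) {f : (Fin n → ℝ) → ℝ} (hf : ∀ᶠ u in 𝓝 x, ContDiffAt ℝ ∞ f u) :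
    pd x k (mk f hf) = mk (fun u => fderiv ℝ f u (Pi.single k 1))
      (eventually_contDiffAt_fderiv hf _) :=
  dirDeriv_mk _ hf

@[simp] theorem pd_const (k : Fin n) (c : ℝ) : pd x k (const x c) = 0 := by
  refine (pd_mk k (Eventually.of_forall fun _ => contDiffAt_const)).trans ?_
  refine Subtype.ext (Germ.coe_eq.2 (Eventually.of_forall fun u => ?_))
  simp

theorem pd_comm (i j : Fin n) (φ : SmoothGerm x) : pd x i (pd x j φ) = pd x j (pd x i φ) := by
  obtain ⟨f, hf, rfl⟩ := exists_eq_mk φ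
  rw [pd_mk, pd_mk, pd_mk, pd_mk, mk_eq_mk]
  filter_upwards [hf] with u hu
  have h1 : DifferentiableAt ℝ (fderiv ℝ f) u :=
    (hu.fderiv_right (m := ∞) (by simp)).differentiableAt (by simp)
  have h2 : IsSymmSndFDerivAt ℝ f u :=
    hu.isSymmSndFDerivAt (by simpa using WithTop.coe_le_coe.2 (le_top : (2 : ℕ∞) ≤ ⊤))
  rw [fderiv_clm_apply h1 (by fun_prop), fderiv_clm_apply h1 (by fun_prop)]
  simpa using h2 _ _

/-- The germ of the coordinate function `uᵏ - xᵏ`, centred at the base point. -/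
def coord (x : Fin n → ℝ) (k : Fin n) : SmoothGerm x :=
  mk (fun u => u k - x k) (Eventually.of_forall fun _ => by fun_prop)

@[simp] theorem ev_coord (k : Fin n) : ev x (coord x k) = 0 := sub_self _

theorem pd_coord (i k : Fin n) : pd x i (coord x k) = if i = k then 1 else 0 := by
  have h : ∀ u, fderiv ℝ (fun u : Fin n → ℝ => u k - x k) u (Pi.single i 1)
      = if i = k then 1 else 0 := by
    intro u
    have h1 : HasFDerivAt (fun u : Fin n → ℝ => u k - x k)
        (ContinuousLinearMap.proj (R := ℝ) (φ := fun _ : Fin n => ℝ) k) u :=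
      (hasFDerivAt_apply k u).sub_const _
    rw [h1.fderiv]
    simp [Pi.single_apply, eq_comm]
  rw [coord, pd_mk]
  simp only [h]
  split_ifs <;> rfl

end SmoothGerm

/-! ### Uniqueness for total systems of linear differential equations -/

namespace SmoothGerm

variable {n : ℕ} {x : Fin n → ℝ}

theorem fderiv_apply_eq_sum (f : (Fin n → ℝ) → ℝ) (u v : Fin n → ℝ) :
    fderiv ℝ f u v = ∑ k, v k * fderiv ℝ f u (Pi.single k 1) := by
  conv_lhs => rw [pi_eq_sum_univ' v]
  simp [map_sum]

theorem rep_sum_mul {ι : Type*} [Fintype ι] (c X : ι → SmoothGerm x) :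
    rep (∑ l, c l * X l) =ᶠ[𝓝 x] fun u => ∑ l, rep (c l) u * rep (X l) u := by
  have hsm : ∀ᶠ u in 𝓝 x, ContDiffAt ℝ ∞ (∑ l, rep (c l) * rep (X l)) u := by
    have : ∀ᶠ u in 𝓝 x, ∀ l, ContDiffAt ℝ ∞ (rep (c l)) u ∧ ContDiffAt ℝ ∞ (rep (X l)) u :=
      eventually_all.2 fun l => (rep_smooth _).and (rep_smooth _)
    filter_upwards [this] with u hu
    have h := ContDiffAt.sum (s := Finset.univ) fun l _ => (hu l).1.mul (hu l).2
    have he : (∑ l, rep (c l) * rep (X l)) = fun u => ∑ l, rep (c l) u * rep (X l) u := by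
      funext u
      simp
    rw [he]
    exact h
  have h : ∑ l, c l * X l = mk (∑ l, rep (c l) * rep (X l)) hsm := by
    refine Subtype.ext ?_
    change ((smoothGerms x).subtype (∑ l, c l * X l)) =
      Germ.coeRingHom (𝓝 x) (∑ l, rep (c l) * rep (X l))
    rw [map_sum, map_sum]
    refine Finset.sum_congr rfl fun l _ => ?_
    rw [map_mul, map_mul]
    conv_lhs => rw [← mk_rep (c l), ← mk_rep (X l)]
    rfl
  rw [h]
  filter_upwards [rep_mk hsm] with u hu
  simp [hu]

/-- A solution of a homogeneous total linear differential system is determined by its value at one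
point: along each ray issuing from the base point it solves a linear ordinary differential
equation, so Grönwall's inequality applies. -/
theorem eq_zero_of_pd_mem_span {ι : Type*} [Fintype ι] (X : ι → SmoothGerm x)
    (h0 : ∀ j, ev x (X j) = 0) (hX : ∀ k j, pd x k (X j) ∈ Ideal.span (Set.range X)) (j : ι) :
    X j = 0 := by
  have hM : ∀ k j, ∃ c : ι → SmoothGerm x, ∑ l, c l * X l = pd x k (X j) :=
    fun k j => Ideal.mem_span_range_iff_exists_fun.1 (hX k j)
  choose M hM using hM
  set f := fun j => rep (X j) with hf
  set m := fun k j l => rep (M k j l) with hm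
  have hder : ∀ᶠ u in 𝓝 x, ∀ k j,
      fderiv ℝ (f j) u (Pi.single k 1) = ∑ l, m k j l u * f l u := by
    simp only [eventually_all]
    intro k j
    have h1 : rep (pd x k (X j)) =ᶠ[𝓝 x] fun u => fderiv ℝ (f j) u (Pi.single k 1) := by
      conv_lhs => rw [← mk_rep (X j), pd_mk]
      exact rep_mk _
    rw [← hM k j] at h1
    filter_upwards [h1, rep_sum_mul (M k j) X] with u hu hu'
    rw [← hu, hu']
  obtain ⟨C, hC⟩ : ∃ C : ℝ, ∀ᶠ u in 𝓝 x, ∀ k j l, |m k j l u| ≤ C := by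
    refine ⟨∑ q : Fin n × ι × ι, (|m q.1 q.2.1 q.2.2 x| + 1), ?_⟩
    simp only [eventually_all]
    intro k j l
    have hc : ContinuousAt (fun u => |m k j l u|) x :=
      (rep_smooth (M k j l)).self_of_nhds.continuousAt.abs
    filter_upwards [hc.eventually_lt_const (lt_add_one _)] with u hu
    refine hu.le.trans ?_
    exact Finset.single_le_sum (f := fun q : Fin n × ι × ι => |m q.1 q.2.1 q.2.2 x| + 1)
      (fun q _ => by positivity) (Finset.mem_univ (k, j, l))
  have hsm : ∀ᶠ u in 𝓝 x, ∀ j, DifferentiableAt ℝ (f j) u := by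
    simp only [eventually_all]
    intro j
    filter_upwards [rep_smooth (X j)] with u hu using hu.differentiableAt (by simp)
  obtain ⟨ε, hε, hball⟩ := Metric.eventually_nhds_iff_ball.1 (hder.and (hC.and hsm))
  suffices h : f j =ᶠ[𝓝 x] fun _ => 0 by
    rw [← mk_rep (X j)]
    exact Subtype.ext (Germ.coe_eq.2 h)
  filter_upwards [Metric.ball_mem_nhds x hε] with u hu
  have hmem : ∀ s ∈ Set.Icc (0 : ℝ) 1, x + s • (u - x) ∈ Metric.ball x ε := by
    intro s hs
    have h := (convex_ball x ε).add_smul_sub_mem (Metric.mem_ball_self hε) hu hs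
    exact h
  -- the system along the ray from `x` to `u`
  set y : ℝ → ι → ℝ := fun s j => f j (x + s • (u - x)) with hy
  set y' : ℝ → ι → ℝ := fun s j => fderiv ℝ (f j) (x + s • (u - x)) (u - x) with hy'
  have hd : ∀ s ∈ Set.Icc (0 : ℝ) 1, HasDerivAt y (y' s) s := by
    intro s hs
    refine hasDerivAt_pi.2 fun j => ?_
    have h1 := ((hball _ (hmem s hs)).2.2 j).hasFDerivAt
    have h2 : HasDerivAt (fun s : ℝ => x + s • (u - x)) (u - x) s := by
      simpa using ((hasDerivAt_id s).smul_const (u - x)).const_add x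
    exact h1.comp_hasDerivAt s h2
  have hbound : ∀ s ∈ Set.Ico (0 : ℝ) 1,
      ‖y' s‖ ≤ (∑ k, |u k - x k| * ∑ _l : ι, C) * ‖y s‖ := by
    intro s hs
    have hb := hball _ (hmem s ⟨hs.1, hs.2.le⟩)
    have hC0 : ∀ (_ : Fin n) (_ : ι), 0 ≤ C := fun k l =>
      (abs_nonneg _).trans (hb.2.1 k l l)
    refine (pi_norm_le_iff_of_nonneg ?_).2 fun j => ?_
    · exact mul_nonneg (Finset.sum_nonneg fun k _ => mul_nonneg (abs_nonneg _)
        (Finset.sum_nonneg fun l _ => hC0 k l)) (norm_nonneg _)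
    · simp only [hy', fderiv_apply_eq_sum (f j) _ (u - x), hb.1]
      rw [Finset.sum_mul]
      refine (norm_sum_le _ _).trans (Finset.sum_le_sum fun k _ => ?_)
      rw [norm_mul, mul_assoc, Finset.sum_mul]
      refine mul_le_mul_of_nonneg_left ?_ (norm_nonneg _)
      refine (norm_sum_le _ _).trans (Finset.sum_le_sum fun l _ => ?_)
      rw [norm_mul]
      exact mul_le_mul (hb.2.1 k j l) (norm_le_pi_norm (y s) l) (norm_nonneg _) (hC0 k l)
  have hz := eq_zero_of_abs_deriv_le_mul_abs_self_of_eq_zero_right (f := y) (f' := y')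
    (fun s hs => (hd s hs).continuousAt.continuousWithinAt)
    (fun s hs => (hd s ⟨hs.1, hs.2.le⟩).hasDerivWithinAt)
    (by
      funext j
      have h := h0 j
      rw [← mk_rep (X j), ev_mk] at h
      simpa [hy] using h) hbound 1 (by simp)
  have := congrFun hz j
  simpa [hy] using this

end SmoothGerm

/-! ### The ideal of eigenvalue jets -/

theorem derivation_mem_of_mem_span {A : Type*} [CommRing A] (D : Derivation ℤ A A) {S : Set A}
    {J : Ideal A} (hS : S ⊆ J) (hD : ∀ s ∈ S, D s ∈ J) {a : A} (ha : a ∈ Ideal.span S) :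
    D a ∈ J := by
  have hle : Ideal.span S ≤ J := Ideal.span_le.2 hS
  refine Submodule.span_induction (p := fun a _ => D a ∈ J) hD (by simp) ?_ ?_ ha
  · intro a b _ _ ha hb
    rw [map_add]
    exact J.add_mem ha hb
  · intro c a ha' ha
    rw [smul_eq_mul, D.leibniz, smul_eq_mul, smul_eq_mul]
    exact J.add_mem (J.mul_mem_left _ ha) (J.mul_mem_right _ (hle ha'))

/-- A moving frame `r₀, r₁, r₂` of column vectors over a commutative ring `A`, with derivations
`d₀, d₁, d₂` of `A` along its members, where `r₂` is the bracket of `r₀` and `r₁`.  The functions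
`G i j k` are the Christoffel symbols, and `c`, `c'` are the structure functions of the brackets
of `d₀`, `d₁` with `d₂`. -/
structure BracketFrame (A : Type*) [CommRing A] where
  r : Fin 3 → Fin 3 → A
  d : Fin 3 → Derivation ℤ A A
  G : Fin 3 → Fin 3 → Fin 3 → A
  c : Fin 3 → A
  c' : Fin 3 → A
  independent : ∀ a : Fin 3 → A, (∀ m, ∑ k, a k * r k m = 0) → ∀ k, a k = 0
  d_r : ∀ i j m, d i (r j m) = ∑ k, G i j k * r k m
  r_two : ∀ m, r 2 m = d 0 (r 1 m) - d 1 (r 0 m)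
  d_two : ∀ φ, d 2 φ = d 0 (d 1 φ) - d 1 (d 0 φ)
  bracket_zero : ∀ φ, d 0 (d 2 φ) - d 2 (d 0 φ) = ∑ k, c k * d k φ
  bracket_one : ∀ φ, d 1 (d 2 φ) - d 2 (d 1 φ) = ∑ k, c' k * d k φ

namespace BracketFrame

variable {A : Type*} [CommRing A] (K : BracketFrame A)

theorem G_sub_G : K.G 0 1 0 = K.G 1 0 0 ∧ K.G 0 1 1 = K.G 1 0 1 ∧ K.G 0 1 2 - K.G 1 0 2 = 1 := by
  have h := K.independent ![K.G 0 1 0 - K.G 1 0 0, K.G 0 1 1 - K.G 1 0 1,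
    K.G 0 1 2 - K.G 1 0 2 - 1] (fun m => by
      have h := K.r_two m
      simp only [K.d_r, Fin.sum_univ_three] at h
      simp only [Fin.sum_univ_three, Matrix.cons_val]
      linear_combination -h)
  have h0 := h 0
  have h1 := h 1
  have h2 := h 2
  simp only [Matrix.cons_val] at h0 h1 h2
  exact ⟨sub_eq_zero.1 h0, sub_eq_zero.1 h1, sub_eq_zero.1 h2⟩

/-- The six scalar equations that express the vanishing of the curvature on a flux `F` with
eigenvalues `l`, `m`, in terms of the components of `d₂ F` in the frame. -/
theorem flux_equations {F : Fin 3 → A} {l m : A} (h0 : ∀ k, K.d 0 (F k) = l * K.r 0 k)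
    (h1 : ∀ k, K.d 1 (F k) = m * K.r 1 k) :
    ∃ b : Fin 3 → A,
      b 0 = -K.d 1 l + (m - l) * K.G 0 1 0 ∧
      b 1 = K.d 0 m + (m - l) * K.G 0 1 1 ∧
      b 2 = m * K.G 0 1 2 - l * K.G 1 0 2 ∧
      (∀ j, K.d 0 (b j) + ∑ k, b k * K.G 0 k j - (if j = 0 then K.d 2 l else 0) - l * K.G 2 0 j
        - ((if j = 0 then K.c 0 * l else 0) + (if j = 1 then K.c 1 * m else 0)
          + K.c 2 * b j) = 0) ∧
      (∀ j, K.d 1 (b j) + ∑ k, b k * K.G 1 k j - (if j = 1 then K.d 2 m else 0) - m * K.G 2 1 j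
        - ((if j = 0 then K.c' 0 * l else 0) + (if j = 1 then K.c' 1 * m else 0)
          + K.c' 2 * b j) = 0) := by
  obtain ⟨g0, g1, -⟩ := K.G_sub_G
  set b : Fin 3 → A := ![-K.d 1 l + (m - l) * K.G 0 1 0, K.d 0 m + (m - l) * K.G 0 1 1,
    m * K.G 0 1 2 - l * K.G 1 0 2] with hb
  have hF2 : ∀ k, K.d 2 (F k) = ∑ j, b j * K.r j k := by
    intro k
    rw [K.d_two, h0, h1]
    simp only [Derivation.leibniz, smul_eq_mul, K.d_r, Fin.sum_univ_three, hb, Matrix.cons_val,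
      g0, g1]
    ring
  refine ⟨b, rfl, rfl, rfl, K.independent _ fun k => ?_, K.independent _ fun k => ?_⟩
  · have h := K.bracket_zero (F k)
    simp only [hF2, h0, h1, Fin.sum_univ_three, map_add, Derivation.leibniz, smul_eq_mul,
      K.d_r] at h
    simp only [Fin.sum_univ_three, Fin.isValue, reduceIte, Fin.reduceEq]
    linear_combination h
  · have h := K.bracket_one (F k)
    simp only [hF2, h0, h1, Fin.sum_univ_three, map_add, Derivation.leibniz, smul_eq_mul,
      K.d_r] at h
    simp only [Fin.sum_univ_three, Fin.isValue, reduceIte, Fin.reduceEq]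
    linear_combination h

/-- The eigenvalues `l`, `m` of a flux, together with `d₁ l`, `d₀ m` and `d₀ d₁ l`, span an ideal
that is stable under the derivations along the frame. -/
theorem d_mem_span {F : Fin 3 → A} {l m : A} (h0 : ∀ k, K.d 0 (F k) = l * K.r 0 k)
    (h1 : ∀ k, K.d 1 (F k) = m * K.r 1 k) (h2 : IsUnit (2 : A)) (hα : IsUnit (K.G 0 1 2))
    (hβ : IsUnit (K.G 1 0 2))
    (hδ : IsUnit (K.G 1 1 2 * K.G 0 0 2 - 9 * K.G 0 1 2 * K.G 1 0 2)) (i : Fin 3) {a : A}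
    (ha : a ∈ Ideal.span {l, m, K.d 1 l, K.d 0 m, K.d 0 (K.d 1 l)}) :
    K.d i a ∈ Ideal.span {l, m, K.d 1 l, K.d 0 m, K.d 0 (K.d 1 l)} := by
  obtain ⟨b, hb0, hb1, hb2, e, e'⟩ := K.flux_equations h0 h1
  obtain ⟨-, -, gab⟩ := K.G_sub_G
  have ha' : ∀ j, K.d 2 j = K.d 0 (K.d 1 j) - K.d 1 (K.d 0 j) := K.d_two
  have hl := ha' l
  have hm := ha' m
  have hcl := K.bracket_zero l
  have hcm := K.bracket_one m
  set p := K.d 1 l with hp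
  set q := K.d 0 m with hq
  set t := K.d 0 p with ht
  set I0 : Ideal A := Ideal.span {l, m} with hI0
  set I1 : Ideal A := Ideal.span {l, m, p, q} with hI1
  set I2 : Ideal A := Ideal.span {l, m, p, q, t} with hI2
  have hI01 : I0 ≤ I1 := Ideal.span_mono (by
    intro s; simp only [Set.mem_insert_iff, Set.mem_singleton_iff]; tauto)
  have hI12 : I1 ≤ I2 := Ideal.span_mono (by
    intro s; simp only [Set.mem_insert_iff, Set.mem_singleton_iff]; tauto)
  have l0 : l ∈ I0 := Ideal.subset_span (by simp)
  have m0 : m ∈ I0 := Ideal.subset_span (by simp)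
  have p1 : p ∈ I1 := Ideal.subset_span (by simp)
  have q1 : q ∈ I1 := Ideal.subset_span (by simp)
  have t2 : t ∈ I2 := Ideal.subset_span (by simp)
  have b01 : b 0 ∈ I1 := by
    rw [hb0]
    exact I1.add_mem (I1.neg_mem p1) (I1.mul_mem_right _ (I1.sub_mem (hI01 m0) (hI01 l0)))
  have b11 : b 1 ∈ I1 := by
    rw [hb1]
    exact I1.add_mem q1 (I1.mul_mem_right _ (I1.sub_mem (hI01 m0) (hI01 l0)))
  have b20 : b 2 ∈ I0 := by
    rw [hb2]
    exact I0.sub_mem (I0.mul_mem_right _ m0) (I0.mul_mem_right _ l0)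
  have e0 := e 0
  have e1 := e 1
  have e2 := e 2
  have e0' := e' 0
  have e1' := e' 1
  have e2' := e' 2
  simp only [Fin.sum_univ_three, Fin.isValue, reduceIte, Fin.reduceEq, hb0, hb1, hb2, map_add,
    map_sub, map_neg, Derivation.leibniz, smul_eq_mul] at e0 e1 e2 e0' e1' e2'
  have L0 : Ideal.Quotient.mk I0 l = 0 := Ideal.Quotient.eq_zero_iff_mem.2 l0
  have M0 : Ideal.Quotient.mk I0 m = 0 := Ideal.Quotient.eq_zero_iff_mem.2 m0
  have L1 : Ideal.Quotient.mk I1 l = 0 := Ideal.Quotient.eq_zero_iff_mem.2 (hI01 l0)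
  have M1 : Ideal.Quotient.mk I1 m = 0 := Ideal.Quotient.eq_zero_iff_mem.2 (hI01 m0)
  have P1 : Ideal.Quotient.mk I1 p = 0 := Ideal.Quotient.eq_zero_iff_mem.2 p1
  have Q1 : Ideal.Quotient.mk I1 q = 0 := Ideal.Quotient.eq_zero_iff_mem.2 q1
  -- first derivatives of the eigenvalues
  have s1 : K.G 1 0 2 * K.d 0 l - (2 * K.G 0 1 2 * q - K.G 0 0 2 * p) ∈ I0 := by
    have h := congrArg (Ideal.Quotient.mk I0) e2
    rw [← Ideal.Quotient.eq_zero_iff_mem]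
    simp only [map_add, map_sub, map_mul, map_neg, map_zero, map_ofNat, L0, M0] at h ⊢
    linear_combination -h
  have s2 : K.G 0 1 2 * K.d 1 m - (2 * K.G 1 0 2 * p - K.G 1 1 2 * q) ∈ I0 := by
    have h := congrArg (Ideal.Quotient.mk I0) e2'
    rw [← Ideal.Quotient.eq_zero_iff_mem]
    simp only [map_add, map_sub, map_mul, map_neg, map_zero, map_ofNat, L0, M0] at h ⊢
    linear_combination h
  have l01 : K.d 0 l ∈ I1 := by
    rw [← Ideal.unit_mul_mem_iff_mem I1 hβ]
    have h := hI01 s1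
    rw [← Ideal.Quotient.eq_zero_iff_mem] at h ⊢
    simp only [map_sub, map_mul, P1, Q1] at h ⊢
    linear_combination h
  have m11 : K.d 1 m ∈ I1 := by
    rw [← Ideal.unit_mul_mem_iff_mem I1 hα]
    have h := hI01 s2
    rw [← Ideal.Quotient.eq_zero_iff_mem] at h ⊢
    simp only [map_sub, map_mul, P1, Q1] at h ⊢
    linear_combination h
  have d0I0 : ∀ a ∈ I0, K.d 0 a ∈ I1 := fun a ha =>
    derivation_mem_of_mem_span (K.d 0) (by rintro s (rfl | rfl); exacts [hI01 l0, hI01 m0])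
      (by rintro s (rfl | rfl); exacts [l01, q1]) ha
  have d1I0 : ∀ a ∈ I0, K.d 1 a ∈ I1 := fun a ha =>
    derivation_mem_of_mem_span (K.d 1) (by rintro s (rfl | rfl); exacts [hI01 l0, hI01 m0])
      (by rintro s (rfl | rfl); exacts [p1, m11]) ha
  have L01 : Ideal.Quotient.mk I1 (K.d 0 l) = 0 := Ideal.Quotient.eq_zero_iff_mem.2 l01
  have M11 : Ideal.Quotient.mk I1 (K.d 1 m) = 0 := Ideal.Quotient.eq_zero_iff_mem.2 m11
  -- second derivatives
  have s3 : K.d 0 q ∈ I1 := by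
    have h := congrArg (Ideal.Quotient.mk I1) e1
    rw [← Ideal.Quotient.eq_zero_iff_mem]
    simp only [map_add, map_sub, map_mul, map_neg, map_zero, L1, M1, P1, Q1, L01, ← hq] at h ⊢
    linear_combination h
  have s4 : K.d 1 p ∈ I1 := by
    have h := congrArg (Ideal.Quotient.mk I1) e0'
    rw [← Ideal.Quotient.eq_zero_iff_mem]
    simp only [map_add, map_sub, map_mul, map_neg, map_zero, L1, M1, P1, Q1, M11, ← hp] at h ⊢
    linear_combination -h
  have s5 : t + K.d 2 l ∈ I1 := by
    have h := congrArg (Ideal.Quotient.mk I1) e0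
    rw [← Ideal.Quotient.eq_zero_iff_mem]
    simp only [map_add, map_sub, map_mul, map_neg, map_zero, L1, M1, P1, Q1, L01, ← hq,
      ← ht] at h ⊢
    linear_combination -h
  have s6 : K.d 1 q - K.d 2 m ∈ I1 := by
    have h := congrArg (Ideal.Quotient.mk I1) e1'
    rw [← Ideal.Quotient.eq_zero_iff_mem]
    simp only [map_add, map_sub, map_mul, map_neg, map_zero, L1, M1, P1, Q1, M11, ← hp] at h ⊢
    linear_combination h
  have D0Q : Ideal.Quotient.mk I1 (K.d 0 q) = 0 := Ideal.Quotient.eq_zero_iff_mem.2 s3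
  have D1P : Ideal.Quotient.mk I1 (K.d 1 p) = 0 := Ideal.Quotient.eq_zero_iff_mem.2 s4
  have s7 : K.G 0 1 2 * K.d 1 q - K.G 1 0 2 * t ∈ I1 := by
    rw [← Ideal.unit_mul_mem_iff_mem I1 h2]
    have h := d1I0 _ s1
    have h5 := s5
    rw [hl] at h5
    rw [← Ideal.Quotient.eq_zero_iff_mem] at h h5 ⊢
    simp only [map_add, map_sub, map_mul, Derivation.leibniz, smul_eq_mul, L01, P1, Q1, D1P,
      map_ofNat] at h h5 ⊢
    linear_combination -h - Ideal.Quotient.mk I1 (K.G 1 0 2) * h5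
  have s8 : K.G 0 1 2 * K.d 2 m - K.G 1 0 2 * t ∈ I1 := by
    have h := I1.sub_mem s7 (I1.mul_mem_left (K.G 0 1 2) s6)
    convert h using 1
    ring
  have q12 : K.d 1 q ∈ I2 := by
    rw [← Ideal.unit_mul_mem_iff_mem I2 hα]
    have h := I2.add_mem (hI12 s7) (I2.mul_mem_left (K.G 1 0 2) t2)
    convert h using 1
    ring
  have d0I1 : ∀ a ∈ I1, K.d 0 a ∈ I2 := fun a ha =>
    derivation_mem_of_mem_span (K.d 0)
      (by rintro s (rfl | rfl | rfl | rfl)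
          exacts [hI12 (hI01 l0), hI12 (hI01 m0), hI12 p1, hI12 q1])
      (by rintro s (rfl | rfl | rfl | rfl)
          exacts [hI12 l01, hI12 q1, t2, hI12 s3]) ha
  have d1I1 : ∀ a ∈ I1, K.d 1 a ∈ I2 := fun a ha =>
    derivation_mem_of_mem_span (K.d 1)
      (by rintro s (rfl | rfl | rfl | rfl)
          exacts [hI12 (hI01 l0), hI12 (hI01 m0), hI12 p1, hI12 q1])
      (by rintro s (rfl | rfl | rfl | rfl)
          exacts [hI12 p1, hI12 m11, hI12 s4, q12]) ha
  have d2I0 : ∀ a ∈ I0, K.d 2 a ∈ I2 := by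
    intro a ha
    rw [K.d_two]
    exact I2.sub_mem (d0I1 _ (d1I0 a ha)) (d1I1 _ (d0I0 a ha))
  have s9 : K.d 2 p + K.d 1 t ∈ I2 := by
    have h := d0I1 _ s4
    rw [K.d_two p, ← ht]
    convert h using 1
    ring
  have T2 : Ideal.Quotient.mk I2 t = 0 := Ideal.Quotient.eq_zero_iff_mem.2 t2
  have P2 : Ideal.Quotient.mk I2 p = 0 := Ideal.Quotient.eq_zero_iff_mem.2 (hI12 p1)
  have Q2 : Ideal.Quotient.mk I2 q = 0 := Ideal.Quotient.eq_zero_iff_mem.2 (hI12 q1)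
  have D1Q : Ideal.Quotient.mk I2 (K.d 1 q) = 0 := Ideal.Quotient.eq_zero_iff_mem.2 q12
  have D0L : Ideal.Quotient.mk I2 (K.d 0 l) = 0 := Ideal.Quotient.eq_zero_iff_mem.2 (hI12 l01)
  have D1M : Ideal.Quotient.mk I2 (K.d 1 m) = 0 := Ideal.Quotient.eq_zero_iff_mem.2 (hI12 m11)
  have D2L : Ideal.Quotient.mk I2 (K.d 2 l) = 0 := Ideal.Quotient.eq_zero_iff_mem.2 (d2I0 l l0)
  have D2M : Ideal.Quotient.mk I2 (K.d 2 m) = 0 := Ideal.Quotient.eq_zero_iff_mem.2 (d2I0 m m0)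
  have s10 : K.G 0 1 2 * K.d 2 q - K.G 1 0 2 * K.d 0 t ∈ I2 := by
    have h := d0I1 _ s7
    have h' := d1I1 _ s3
    rw [K.d_two q]
    rw [← Ideal.Quotient.eq_zero_iff_mem] at h h' ⊢
    simp only [map_sub, map_mul, Derivation.leibniz, smul_eq_mul, T2, D1Q, map_add] at h h' ⊢
    linear_combination h - Ideal.Quotient.mk I2 (K.G 0 1 2) * h'
  -- the derivatives of `t` solve a linear system with an invertible determinant
  have s11 : 3 * K.G 1 0 2 * K.d 0 t + K.G 0 0 2 * K.d 1 t ∈ I2 := by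
    have h1 := d0I1 _ s5
    have h2 := d2I0 _ s1
    have h3 := congrArg (Ideal.Quotient.mk I2) hcl
    have h9 := s9
    have h10 := s10
    rw [← Ideal.Quotient.eq_zero_iff_mem] at h1 h2 h9 h10 ⊢
    simp only [map_sub, map_mul, Derivation.leibniz, smul_eq_mul, map_add, Fin.sum_univ_three,
      P2, Q2, D0L, D2L, ← hp, map_ofNat] at h1 h2 h3 h9 h10 ⊢
    linear_combination Ideal.Quotient.mk I2 (K.G 1 0 2) * (h1 - h3) - h2
      - 2 * h10 + Ideal.Quotient.mk I2 (K.G 0 0 2) * h9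
  have s12 : 3 * K.G 0 1 2 * K.d 1 t + K.G 1 1 2 * K.d 0 t ∈ I2 := by
    rw [← Ideal.unit_mul_mem_iff_mem I2 hβ]
    have h1 := d1I1 _ s8
    have h2 := d2I0 _ s2
    have h3 := congrArg (Ideal.Quotient.mk I2) hcm
    have h9 := s9
    have h10 := s10
    rw [← Ideal.Quotient.eq_zero_iff_mem] at h1 h2 h9 h10 ⊢
    simp only [map_sub, map_mul, Derivation.leibniz, smul_eq_mul, map_add, Fin.sum_univ_three,
      P2, Q2, T2, D1M, D2M, ← hq, map_ofNat] at h1 h2 h3 h9 h10 ⊢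
    linear_combination -Ideal.Quotient.mk I2 (K.G 0 1 2) *
        (h1 - h2 - Ideal.Quotient.mk I2 (K.G 0 1 2) * h3)
      + 2 * Ideal.Quotient.mk I2 (K.G 0 1 2) * Ideal.Quotient.mk I2 (K.G 1 0 2) * h9
      - Ideal.Quotient.mk I2 (K.G 1 1 2) * h10
  have t02 : K.d 0 t ∈ I2 := by
    rw [← Ideal.unit_mul_mem_iff_mem I2 hδ]
    have h := I2.sub_mem (I2.mul_mem_left (K.G 0 0 2) s12) (I2.mul_mem_left (3 * K.G 0 1 2) s11)
    convert h using 1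
    ring
  have t12 : K.d 1 t ∈ I2 := by
    rw [← Ideal.unit_mul_mem_iff_mem I2 hδ]
    have h := I2.sub_mem (I2.mul_mem_left (K.G 1 1 2) s11) (I2.mul_mem_left (3 * K.G 1 0 2) s12)
    convert h using 1
    ring
  have hI2 : ({l, m, p, q, t} : Set A) ⊆ I2 := Ideal.subset_span
  have d0I2 : ∀ a ∈ I2, K.d 0 a ∈ I2 := fun a ha =>
    derivation_mem_of_mem_span (K.d 0) hI2
      (by rintro s (rfl | rfl | rfl | rfl | rfl)
          exacts [hI12 l01, hI12 q1, t2, hI12 s3, t02]) ha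
  have d1I2 : ∀ a ∈ I2, K.d 1 a ∈ I2 := fun a ha =>
    derivation_mem_of_mem_span (K.d 1) hI2
      (by rintro s (rfl | rfl | rfl | rfl | rfl)
          exacts [hI12 p1, hI12 m11, hI12 s4, q12, t12]) ha
  fin_cases i
  · exact d0I2 a ha
  · exact d1I2 a ha
  · change K.d 2 a ∈ I2
    rw [K.d_two]
    exact I2.sub_mem (d0I2 _ (d1I2 a ha)) (d1I2 _ (d0I2 a ha))

end BracketFrame

/-! ### Vector fields and fluxes as germs -/

namespace SmoothGerm

variable {n : ℕ} {x : Fin n → ℝ}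

/-- The derivation of the ring of smooth germs along a vector field with components `r`. -/
noncomputable def along (r : Fin n → SmoothGerm x) : Derivation ℤ (SmoothGerm x) (SmoothGerm x) :=
  ∑ k, r k • pd x k

theorem along_apply (r : Fin n → SmoothGerm x) (φ : SmoothGerm x) :
    along r φ = ∑ k, r k * pd x k φ := by
  have h := congrFun (map_sum Derivation.coeFnAddMonoidHom (fun k => r k • pd x k) Finset.univ) φ
  refine h.trans ?_
  simp [Derivation.coeFnAddMonoidHom_apply]

theorem along_sum_mul {ι : Type*} [Fintype ι] (c : ι → SmoothGerm x)
    (r : ι → Fin n → SmoothGerm x) (φ : SmoothGerm x) :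
    along (fun m => ∑ i, c i * r i m) φ = ∑ i, c i * along (r i) φ := by
  simp only [along_apply, Finset.sum_mul, Finset.mul_sum]
  rw [Finset.sum_comm]
  simp only [mul_assoc]

/-- The commutator of the derivations along two vector fields is the derivation along their
Lie bracket. -/
theorem along_along_sub (r s : Fin n → SmoothGerm x) (φ : SmoothGerm x) :
    along r (along s φ) - along s (along r φ) =
      along (fun m => along r (s m) - along s (r m)) φ := by
  have h : ∀ r s : Fin n → SmoothGerm x, along r (along s φ) =
      ∑ j, along r (s j) * pd x j φ + ∑ k, ∑ j, r k * s j * pd x k (pd x j φ) := by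
    intro r s
    rw [along_apply s, map_sum]
    simp only [Derivation.leibniz, smul_eq_mul]
    rw [Finset.sum_add_distrib, add_comm]
    congr 1
    · exact Finset.sum_congr rfl fun j _ => mul_comm _ _
    · simp only [along_apply r, Finset.mul_sum]
      rw [Finset.sum_comm]
      exact Finset.sum_congr rfl fun k _ => Finset.sum_congr rfl fun j _ => by ring
  rw [h r s, h s r, along_apply]
  simp only [sub_mul, Finset.sum_sub_distrib]
  have h2 : ∑ k, ∑ j, s k * r j * pd x k (pd x j φ) =
      ∑ k, ∑ j, r k * s j * pd x k (pd x j φ) := by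
    rw [Finset.sum_comm]
    refine Finset.sum_congr rfl fun k _ => Finset.sum_congr rfl fun j _ => ?_
    rw [pd_comm]
    ring
  rw [h2]
  ring

@[simp] theorem along_const (r : Fin n → SmoothGerm x) (c : ℝ) : along r (const x c) = 0 := by
  simp [along_apply]

theorem along_coord (r : Fin n → SmoothGerm x) (k : Fin n) : along r (coord x k) = r k := by
  simp [along_apply, pd_coord]

theorem comp_smooth {S : VField n} (hS : ∀ᶠ u in 𝓝 x, ContDiffAt ℝ ∞ S u) (k : Fin n) :
    ∀ᶠ u in 𝓝 x, ContDiffAt ℝ ∞ (fun u => S u k) u := by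
  filter_upwards [hS] with u hu using contDiffAt_pi.1 hu k

/-- The components of a vector field that is smooth near `x`, as germs at `x`. -/
def ofField (S : VField n) (hS : ∀ᶠ u in 𝓝 x, ContDiffAt ℝ ∞ S u) (k : Fin n) : SmoothGerm x :=
  mk (fun u => S u k) (comp_smooth hS k)

@[simp] theorem ev_ofField (S : VField n) (hS : ∀ᶠ u in 𝓝 x, ContDiffAt ℝ ∞ S u) (k : Fin n) :
    ev x (ofField S hS k) = S x k := rfl

theorem eventually_contDiffAt_nabla {R S : VField n} (hR : ∀ᶠ u in 𝓝 x, ContDiffAt ℝ ∞ R u)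
    (hS : ∀ᶠ u in 𝓝 x, ContDiffAt ℝ ∞ S u) : ∀ᶠ u in 𝓝 x, ContDiffAt ℝ ∞ (nabla R S) u := by
  filter_upwards [hR, hS] with u h1 h2
  exact (h2.fderiv_right (m := ∞) (by simp)).clm_apply h1

theorem nabla_apply_eq_sum {R S : VField n} {u : Fin n → ℝ} (hS : DifferentiableAt ℝ S u)
    (k : Fin n) :
    nabla R S u k = ∑ j, R u j * fderiv ℝ (fun u => S u k) u (Pi.single j 1) := by
  rw [← fderiv_apply_eq_sum, nabla, fderiv_apply hS]
  rfl

theorem coe_sum_mul_mk {ι : Type*} [Fintype ι] (f g : ι → (Fin n → ℝ) → ℝ)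
    (hf : ∀ i, ∀ᶠ u in 𝓝 x, ContDiffAt ℝ ∞ (f i) u)
    (hg : ∀ i, ∀ᶠ u in 𝓝 x, ContDiffAt ℝ ∞ (g i) u) :
    ((∑ i, mk (f i) (hf i) * mk (g i) (hg i) : SmoothGerm x) : Germ (𝓝 x) ℝ) =
      ((fun u => ∑ i, f i u * g i u : (Fin n → ℝ) → ℝ) : Germ (𝓝 x) ℝ) := by
  rw [← mk_rep (∑ i, mk (f i) (hf i) * mk (g i) (hg i) : SmoothGerm x)]
  refine Germ.coe_eq.2 ?_
  have h1 : ∀ᶠ u in 𝓝 x, ∀ i, rep (mk (f i) (hf i)) u = f i u :=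
    eventually_all.2 fun i => rep_mk _
  have h2 : ∀ᶠ u in 𝓝 x, ∀ i, rep (mk (g i) (hg i)) u = g i u :=
    eventually_all.2 fun i => rep_mk _
  filter_upwards [rep_sum_mul (fun i => mk (f i) (hf i)) fun i => mk (g i) (hg i), h1, h2]
    with u h h1 h2
  rw [h]
  simp only [h1, h2]

theorem along_ofField {R S : VField n} (hR : ∀ᶠ u in 𝓝 x, ContDiffAt ℝ ∞ R u)
    (hS : ∀ᶠ u in 𝓝 x, ContDiffAt ℝ ∞ S u) (k : Fin n) :
    along (ofField R hR) (ofField S hS k) =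
      ofField (nabla R S) (eventually_contDiffAt_nabla hR hS) k := by
  rw [along_apply]
  simp only [ofField, pd_mk]
  refine Subtype.ext ?_
  rw [coe_sum_mul_mk]
  refine Germ.coe_eq.2 ?_
  filter_upwards [hS] with u hu
  rw [nabla_apply_eq_sum (hu.differentiableAt (by simp))]

/-- The germ of the map whose components have the germs `F k`. -/
noncomputable def toGerm (F : Fin n → SmoothGerm x) : Germ (𝓝 x) (Fin n → ℝ) :=
  ((fun u k => rep (F k) u : VField n) : Germ (𝓝 x) (Fin n → ℝ))

theorem toGerm_ofField (S : VField n) (hS : ∀ᶠ u in 𝓝 x, ContDiffAt ℝ ∞ S u) :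
    toGerm (ofField S hS) = (S : Germ (𝓝 x) (Fin n → ℝ)) := by
  refine Germ.coe_eq.2 ?_
  have h : ∀ᶠ u in 𝓝 x, ∀ k, rep (ofField S hS k) u = S u k :=
    eventually_all.2 fun k => rep_mk _
  filter_upwards [h] with u hu
  exact funext hu

theorem exists_eq_ofField (F : Fin n → SmoothGerm x) : ∃ S hS, F = ofField (x := x) S hS := by
  have hS : ∀ᶠ u in 𝓝 x, ContDiffAt ℝ ∞ (fun u k => rep (F k) u : VField n) u := by
    have h : ∀ᶠ u in 𝓝 x, ∀ k, ContDiffAt ℝ ∞ (rep (F k)) u :=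
      eventually_all.2 fun k => rep_smooth _
    filter_upwards [h] with u hu
    exact contDiffAt_pi.2 hu
  exact ⟨_, hS, funext fun k => (mk_rep (F k)).symm⟩

theorem toGerm_injective : Function.Injective (toGerm (x := x)) := by
  intro F G h
  obtain ⟨S, hS, rfl⟩ := exists_eq_ofField F
  obtain ⟨T, hT, rfl⟩ := exists_eq_ofField G
  rw [toGerm_ofField, toGerm_ofField, Germ.coe_eq] at h
  funext k
  refine mk_eq_mk.2 ?_
  filter_upwards [h] with u hu
  rw [hu]

theorem toGerm_add (F G : Fin n → SmoothGerm x) : toGerm (F + G) = toGerm F + toGerm G := by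
  obtain ⟨S, hS, rfl⟩ := exists_eq_ofField F
  obtain ⟨T, hT, rfl⟩ := exists_eq_ofField G
  have hST : ∀ᶠ u in 𝓝 x, ContDiffAt ℝ ∞ (S + T) u := by
    filter_upwards [hS, hT] with u h1 h2 using h1.add h2
  have : ofField S hS + ofField T hT = ofField (S + T) hST := rfl
  rw [this, toGerm_ofField, toGerm_ofField, toGerm_ofField]
  rfl

theorem toGerm_const_mul (c : ℝ) (F : Fin n → SmoothGerm x) :
    toGerm (fun k => const x c * F k) = c • toGerm F := by
  obtain ⟨S, hS, rfl⟩ := exists_eq_ofField F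
  have hcS : ∀ᶠ u in 𝓝 x, ContDiffAt ℝ ∞ (c • S) u := by
    filter_upwards [hS] with u h1 using h1.const_smul c
  have : (fun k => const x c * ofField S hS k) = ofField (c • S) hcS := rfl
  rw [this, toGerm_ofField, toGerm_ofField]
  rfl

end SmoothGerm

open SmoothGerm

/-- The germs `F` of maps and `l` of functions satisfy `∇_{r_i} F = lⁱ r_i` for all `i`. -/
def IsGermFlux {m n : ℕ} {x : Fin n → ℝ} (r : Fin m → Fin n → SmoothGerm x)
    (F : Fin n → SmoothGerm x) (l : Fin m → SmoothGerm x) : Prop :=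
  ∀ i k, along (r i) (F k) = l i * r i k

theorem mem_fluxSpace_iff {m n : ℕ} {x : Fin n → ℝ} {R : Fin m → VField n}
    (hR : ∀ i, ∀ᶠ u in 𝓝 x, ContDiffAt ℝ ∞ (R i) u) (φ : Germ (𝓝 x) (Fin n → ℝ)) :
    φ ∈ fluxSpace R x ↔ ∃ (F : Fin n → SmoothGerm x) (l : Fin m → SmoothGerm x),
      IsGermFlux (fun i => ofField (R i) (hR i)) F l ∧ φ = toGerm F := by
  constructor
  · rintro ⟨F, Ω, hΩ, hx, ⟨hF, l, hl, h⟩, rfl⟩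
    have hΩx := hΩ.mem_nhds hx
    have hF' : ∀ᶠ u in 𝓝 x, ContDiffAt ℝ ∞ F u := by
      filter_upwards [hΩx] with u hu using hF.contDiffAt (hΩ.mem_nhds hu)
    have hl' : ∀ i, ∀ᶠ u in 𝓝 x, ContDiffAt ℝ ∞ (l i) u := by
      intro i
      filter_upwards [hΩx] with u hu using (hl i).contDiffAt (hΩ.mem_nhds hu)
    refine ⟨ofField F hF', fun i => mk (l i) (hl' i), fun i k => ?_, (toGerm_ofField _ _).symm⟩
    rw [along_ofField]
    refine Subtype.ext (Germ.coe_eq.2 ?_)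
    filter_upwards [hΩx] with u hu
    rw [h i u hu]
    rfl
  · rintro ⟨F, l, h, rfl⟩
    obtain ⟨S, hS, rfl⟩ := exists_eq_ofField F
    rw [toGerm_ofField]
    have h1 : ∀ᶠ u in 𝓝 x, ∀ i k, nabla (R i) S u k = rep (l i) u * R i u k := by
      simp only [eventually_all]
      intro i k
      have h2 := h i k
      rw [along_ofField, ← mk_rep (l i)] at h2
      exact Germ.coe_eq.1 (congrArg Subtype.val h2)
    have h3 : ∀ᶠ u in 𝓝 x, ∀ i, ContDiffAt ℝ ∞ (rep (l i)) u :=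
      eventually_all.2 fun i => rep_smooth _
    obtain ⟨Ω, hΩ, ho, hx⟩ := eventually_nhds_iff.1 (hS.and (h1.and h3))
    refine ⟨S, Ω, ho, hx, ⟨fun u hu => (hΩ u hu).1.contDiffWithinAt, fun i => rep (l i),
      fun i u hu => ((hΩ u hu).2.2 i).contDiffWithinAt, fun i u hu => ?_⟩, rfl⟩
    funext k
    exact (hΩ u hu).2.1 i k

theorem mem_trivialFluxes_iff {n : ℕ} {x : Fin n → ℝ} (F : Fin n → SmoothGerm x) :
    toGerm F ∈ trivialFluxes x ↔ ∃ (c : ℝ) (a : Fin n → ℝ),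
      ∀ k, F k = const x c * coord x k + const x (a k) := by
  have key : ∀ (c : ℝ) (a : Fin n → ℝ), toGerm (fun k => const x c * coord x k + const x (a k)) =
      ((fun u => c • u + (a - c • x) : VField n) : Germ (𝓝 x) (Fin n → ℝ)) := by
    intro c a
    have hS : ∀ᶠ u in 𝓝 x, ContDiffAt ℝ ∞ (fun u => c • (u - x) + a : VField n) u :=
      Eventually.of_forall fun u => by fun_prop
    have : (fun k => const x c * coord x k + const x (a k)) =
      ofField (fun u => c • (u - x) + a : VField n) hS := rfl
    rw [this, toGerm_ofField]
    congr 1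
    funext u
    module
  constructor
  · rintro ⟨c, a, h⟩
    refine ⟨c, a + c • x, fun k => ?_⟩
    have h2 := key c (a + c • x)
    rw [add_sub_cancel_right, ← h] at h2
    exact congrFun (toGerm_injective h2.symm) k
  · rintro ⟨c, a, h⟩
    rw [funext h, key]
    exact ⟨c, _, rfl⟩

/-! ### Fluxes with vanishing jet are trivial -/

section Frame

variable {x : Fin 3 → ℝ}

/-- The components of the Lie bracket of two vector fields, as germs. -/
noncomputable def bracketGerm (r s : Fin 3 → SmoothGerm x) (m : Fin 3) : SmoothGerm x :=
  along r (s m) - along s (r m)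

/-- The matrix whose columns are two vector fields and their Lie bracket. -/
noncomputable def frameMatrix (r s : Fin 3 → SmoothGerm x) :
    Matrix (Fin 3) (Fin 3) (SmoothGerm x) :=
  Matrix.of fun m k => (![r, s, bracketGerm r s] : Fin 3 → Fin 3 → SmoothGerm x) k m

/-- The coefficients of a vector field in the frame of two vector fields and their bracket. -/
noncomputable def frameCoeff (r s v : Fin 3 → SmoothGerm x) : Fin 3 → SmoothGerm x :=
  (frameMatrix r s)⁻¹.mulVec v

theorem sum_frameCoeff {r s : Fin 3 → SmoothGerm x} (h : IsUnit (frameMatrix r s).det)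
    (v : Fin 3 → SmoothGerm x) (m : Fin 3) :
    ∑ k, frameCoeff r s v k * (![r, s, bracketGerm r s] : Fin 3 → Fin 3 → SmoothGerm x) k m
      = v m := by
  have h1 : (frameMatrix r s).mulVec (frameCoeff r s v) = v := by
    rw [frameCoeff, Matrix.mulVec_mulVec, Matrix.mul_nonsing_inv _ h, Matrix.one_mulVec]
  have h2 := congrFun h1 m
  rw [← h2]
  exact Finset.sum_congr rfl fun k _ => mul_comm _ _

theorem along_eq_sum_frameCoeff {r s : Fin 3 → SmoothGerm x} (h : IsUnit (frameMatrix r s).det)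
    (v : Fin 3 → SmoothGerm x) (φ : SmoothGerm x) :
    along v φ = ∑ k, frameCoeff r s v k *
      along ((![r, s, bracketGerm r s] : Fin 3 → Fin 3 → SmoothGerm x) k) φ := by
  rw [← along_sum_mul]
  congr 2
  funext m
  exact (sum_frameCoeff h v m).symm

/-- The frame formed by two vector fields and their Lie bracket. -/
noncomputable def bracketFrame (r s : Fin 3 → SmoothGerm x) (h : IsUnit (frameMatrix r s).det) :
    BracketFrame (SmoothGerm x) where
  r := ![r, s, bracketGerm r s]
  d i := along ((![r, s, bracketGerm r s] : Fin 3 → Fin 3 → SmoothGerm x) i)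
  G i j := frameCoeff r s fun m =>
    along ((![r, s, bracketGerm r s] : Fin 3 → Fin 3 → SmoothGerm x) i)
      ((![r, s, bracketGerm r s] : Fin 3 → Fin 3 → SmoothGerm x) j m)
  c := frameCoeff r s (bracketGerm r (bracketGerm r s))
  c' := frameCoeff r s (bracketGerm s (bracketGerm r s))
  independent a ha k := by
    have h1 : (frameMatrix r s).mulVec a = 0 := by
      funext m
      exact (Finset.sum_congr rfl fun k _ => mul_comm _ _).trans (ha m)
    have h2 : a = (frameMatrix r s)⁻¹.mulVec ((frameMatrix r s).mulVec a) := by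
      rw [Matrix.mulVec_mulVec, Matrix.nonsing_inv_mul _ h, Matrix.one_mulVec]
    rw [h2, h1, Matrix.mulVec_zero]
    rfl
  d_r i j m := (sum_frameCoeff h (fun m =>
    along ((![r, s, bracketGerm r s] : Fin 3 → Fin 3 → SmoothGerm x) i)
      ((![r, s, bracketGerm r s] : Fin 3 → Fin 3 → SmoothGerm x) j m)) m).symm
  r_two _ := rfl
  d_two φ := (along_along_sub r s φ).symm
  bracket_zero φ := (along_along_sub r (bracketGerm r s) φ).trans (along_eq_sum_frameCoeff h _ φ)
  bracket_one φ := (along_along_sub s (bracketGerm r s) φ).trans (along_eq_sum_frameCoeff h _ φ)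

theorem pd_eq_along (k : Fin 3) (φ : SmoothGerm x) :
    pd x k φ = along (fun m => if m = k then 1 else 0) φ := by
  simp [along_apply]

/-- A germ annihilated by two fields is annihilated by their bracket too; so it is constant if the
three form a frame. -/
theorem eq_const_of_along_eq_zero {r s : Fin 3 → SmoothGerm x}
    (h : IsUnit (frameMatrix r s).det) {φ : SmoothGerm x} (h0 : along r φ = 0)
    (h1 : along s φ = 0) : φ = const x (ev x φ) := by
  have h2 : along (bracketGerm r s) φ = 0 := by
    have := along_along_sub r s φ
    rw [h0, h1, map_zero, map_zero, sub_zero] at this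
    exact this.symm
  have hpd : ∀ k, pd x k φ = 0 := by
    intro k
    rw [pd_eq_along, along_eq_sum_frameCoeff h, Fin.sum_univ_three]
    simp [h0, h1, h2]
  refine sub_eq_zero.1 (eq_zero_of_pd_mem_span (fun _ : Unit => φ - const x (ev x φ))
    (by simp) (fun k _ => ?_) ())
  rw [map_sub, hpd, pd_const, sub_zero]
  exact Ideal.zero_mem _

/-- The values at the base point of the functions by which a flux with eigenvalues `l` is
determined up to trivial fluxes: the difference of the eigenvalues, the derivative of each
eigenvalue along the other vector field, and one second derivative. -/
noncomputable def fluxJet (r : Fin 2 → Fin 3 → SmoothGerm x) (l : Fin 2 → SmoothGerm x) :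
    Fin 4 → ℝ :=
  ![ev x (l 1 - l 0), ev x (along (r 1) (l 0)), ev x (along (r 0) (l 1)),
    ev x (along (r 0) (along (r 1) (l 0)))]

/-- A flux is trivial if its jet at the base point vanishes. -/
theorem IsGermFlux.exists_eq_of_fluxJet_eq_zero {r : Fin 2 → Fin 3 → SmoothGerm x}
    {F : Fin 3 → SmoothGerm x} {l : Fin 2 → SmoothGerm x} (hF : IsGermFlux r F l)
    (h : IsUnit (frameMatrix (r 0) (r 1)).det)
    (hα : IsUnit ((bracketFrame (r 0) (r 1) h).G 0 1 2))
    (hβ : IsUnit ((bracketFrame (r 0) (r 1) h).G 1 0 2))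
    (hδ : IsUnit ((bracketFrame (r 0) (r 1) h).G 1 1 2 * (bracketFrame (r 0) (r 1) h).G 0 0 2
      - 9 * (bracketFrame (r 0) (r 1) h).G 0 1 2 * (bracketFrame (r 0) (r 1) h).G 1 0 2))
    (hj : fluxJet r l = 0) :
    ∃ (c : ℝ) (a : Fin 3 → ℝ), ∀ k, F k = const x c * coord x k + const x (a k) := by
  set c := ev x (l 0) with hc
  set K := bracketFrame (r 0) (r 1) h with hK
  have hr0 : K.r 0 = r 0 := rfl
  have hr1 : K.r 1 = r 1 := rfl
  have hd0 : K.d 0 = along (r 0) := rfl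
  have hd1 : K.d 1 = along (r 1) := rfl
  set G : Fin 3 → SmoothGerm x := fun k => F k - const x c * coord x k with hG
  set p := l 0 - const x c with hp
  set q := l 1 - const x c with hq
  have h0 : ∀ k, K.d 0 (G k) = p * K.r 0 k := by
    intro k
    have := hF 0 k
    simp only [hd0, hr0, hG, map_sub, Derivation.leibniz, smul_eq_mul, along_const, along_coord,
      this, hp]
    ring
  have h1 : ∀ k, K.d 1 (G k) = q * K.r 1 k := by
    intro k
    have := hF 1 k
    simp only [hd1, hr1, hG, map_sub, Derivation.leibniz, smul_eq_mul, along_const, along_coord,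
      this, hq]
    ring
  have h2 : IsUnit (2 : SmoothGerm x) := isUnit_of_ev_ne_zero (by simp [map_ofNat (ev x) 2])
  have hmem := fun i a ha => K.d_mem_span h0 h1 h2 hα hβ hδ i (a := a) ha
  set X : Fin 5 → SmoothGerm x := ![p, q, K.d 1 p, K.d 0 q, K.d 0 (K.d 1 p)] with hX
  have hspan : Ideal.span (Set.range X) =
      Ideal.span {p, q, K.d 1 p, K.d 0 q, K.d 0 (K.d 1 p)} := by
    congr 1
    ext y
    simp only [hX, Matrix.range_cons, Matrix.range_empty, Set.union_empty, Set.mem_union,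
      Set.mem_insert_iff, Set.mem_singleton_iff]
  have j0 := congrFun hj 0
  have j1 := congrFun hj 1
  have j2 := congrFun hj 2
  have j3 := congrFun hj 3
  simp only [fluxJet, Matrix.cons_val, Pi.zero_apply, map_sub] at j0 j1 j2 j3
  -- the eigenvalues of `F - c u` and their derivatives solve a homogeneous total system
  have hX0 : ∀ j, X j = 0 := by
    refine eq_zero_of_pd_mem_span X ?_ ?_
    · intro j
      fin_cases j
      · simp [hX, hp, hc]
      · simpa [hX, hq, hc] using j0
      · simpa [hX, hp, hd1] using j1
      · simpa [hX, hq, hd0] using j2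
      · simpa [hX, hp, hd0, hd1] using j3
    · intro k j
      rw [hspan, pd_eq_along, along_eq_sum_frameCoeff h]
      refine Ideal.sum_mem _ fun i _ => Ideal.mul_mem_left _ _ (hmem i _ ?_)
      rw [← hspan]
      exact Ideal.subset_span ⟨j, rfl⟩
  have hp0 : p = 0 := hX0 0
  have hq0 : q = 0 := hX0 1
  refine ⟨c, fun k => ev x (G k), fun k => ?_⟩
  have hk := eq_const_of_along_eq_zero h (φ := G k) ((h0 k).trans (by rw [hp0, zero_mul]))
    ((h1 k).trans (by rw [hq0, zero_mul]))
  rw [← hk]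
  simp [hG]

end Frame

namespace SizeHypotheses

variable {ubar : Fin 3 → ℝ} {R : Fin 2 → VField 3} {s : VField 3}

theorem eventually_contDiffAt (H : SizeHypotheses ubar R s) (i : Fin 2) :
    ∀ᶠ u in 𝓝 ubar, ContDiffAt ℝ ∞ (R i) u := by
  obtain ⟨Ω, ho, hu, hR⟩ := H.partialFrame
  filter_upwards [ho.mem_nhds hu] with u h using (hR.smooth i).contDiffAt (ho.mem_nhds h)

/-- The components of the vector fields, as germs. -/
def germ (H : SizeHypotheses ubar R s) (i : Fin 2) : Fin 3 → SmoothGerm ubar :=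
  ofField (R i) (H.eventually_contDiffAt i)

theorem ev_bracketGerm (H : SizeHypotheses ubar R s) (m : Fin 3) :
    ev ubar (bracketGerm (H.germ 0) (H.germ 1) m) =
      VectorField.lieBracket ℝ (R 0) (R 1) ubar m := by
  simp only [bracketGerm, germ, along_ofField, map_sub, ev_ofField]
  rfl

theorem isUnit_det (H : SizeHypotheses ubar R s) :
    IsUnit (frameMatrix (H.germ 0) (H.germ 1)).det := by
  refine isUnit_of_ev_ne_zero ?_
  rw [RingHom.map_det]
  have hlin : LinearIndependent ℝ
      ![R 0 ubar, R 1 ubar, VectorField.lieBracket ℝ (R 0) (R 1) ubar] := by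
    obtain ⟨Ω, -, hu, hR⟩ := H.partialFrame
    have h1 := hR.independent ubar hu
    have h2 : VectorField.lieBracket ℝ (R 0) (R 1) ubar ∉
        Submodule.span ℝ (Set.range fun i => R i ubar) := by
      have hr : (Set.range fun i => R i ubar) = {R 0 ubar, R 1 ubar} := by
        ext y
        simp [Fin.exists_fin_two, eq_comm]
      rw [hr]
      exact H.nonInvolutive
    have hs : ![R 0 ubar, R 1 ubar, VectorField.lieBracket ℝ (R 0) (R 1) ubar] =
        Fin.snoc (fun i => R i ubar) (VectorField.lieBracket ℝ (R 0) (R 1) ubar) := by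
      funext k
      fin_cases k <;> rfl
    rw [hs]
    exact linearIndependent_finSnoc.2 ⟨h1, h2⟩
  have hunit : IsUnit ((ev ubar).mapMatrix (frameMatrix (H.germ 0) (H.germ 1))) := by
    rw [← Matrix.linearIndependent_cols_iff_isUnit]
    have hcol : ((ev ubar).mapMatrix (frameMatrix (H.germ 0) (H.germ 1))).col =
        ![R 0 ubar, R 1 ubar, VectorField.lieBracket ℝ (R 0) (R 1) ubar] := by
      funext k m
      fin_cases k
      · rfl
      · rfl
      · exact H.ev_bracketGerm m
    rw [hcol]
    exact hlin
  exact ((Matrix.isUnit_iff_isUnit_det _).1 hunit).ne_zero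

theorem nabla_eq_sum (H : SizeHypotheses ubar R s) (i j : Fin 2) (m : Fin 3) :
    nabla (R i) (R j) ubar m =
      ev ubar ((bracketFrame _ _ H.isUnit_det).G i.castSucc j.castSucc 0) * R 0 ubar m +
      ev ubar ((bracketFrame _ _ H.isUnit_det).G i.castSucc j.castSucc 1) * R 1 ubar m +
      ev ubar ((bracketFrame _ _ H.isUnit_det).G i.castSucc j.castSucc 2) *
        VectorField.lieBracket ℝ (R 0) (R 1) ubar m := by
  have h := congrArg (ev ubar) ((bracketFrame _ _ H.isUnit_det).d_r i.castSucc j.castSucc m)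
  rw [Fin.sum_univ_three] at h
  simp only [map_add, map_mul] at h
  rw [← H.ev_bracketGerm]
  refine Eq.trans ?_ h
  have h1 : ∀ i j, along (H.germ i) (H.germ j m) =
      ofField (nabla (R i) (R j)) (eventually_contDiffAt_nabla (H.eventually_contDiffAt i)
        (H.eventually_contDiffAt j)) m := fun i j => along_ofField _ _ m
  have h2 := congrArg (ev ubar) (h1 i j)
  refine h2.symm.trans ?_
  fin_cases i <;> fin_cases j <;> rfl

/-- The assumptions on the frame completed by `s` carry over to the frame completed by the
bracket. -/
theorem units (H : SizeHypotheses ubar R s) :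
    IsUnit ((bracketFrame _ _ H.isUnit_det).G 0 1 2) ∧
    IsUnit ((bracketFrame _ _ H.isUnit_det).G 1 0 2) ∧
    IsUnit ((bracketFrame _ _ H.isUnit_det).G 1 1 2 * (bracketFrame _ _ H.isUnit_det).G 0 0 2
      - 9 * (bracketFrame _ _ H.isUnit_det).G 0 1 2 * (bracketFrame _ _ H.isUnit_det).G 1 0 2) := by
  have hspan : ∀ i j, nabla (R i) (R j) ubar ∉ Submodule.span ℝ {R 0 ubar, R 1 ubar} →
      ev ubar ((bracketFrame _ _ H.isUnit_det).G i.castSucc j.castSucc 2) ≠ 0 := by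
    intro i j h h0
    refine h (Submodule.mem_span_pair.2
      ⟨ev ubar ((bracketFrame _ _ H.isUnit_det).G i.castSucc j.castSucc 0),
        ev ubar ((bracketFrame _ _ H.isUnit_det).G i.castSucc j.castSucc 1), funext fun m => ?_⟩)
    rw [H.nabla_eq_sum i j m, h0]
    simp
  refine ⟨isUnit_of_ev_ne_zero (hspan 0 1 H.nabla_zero_one),
    isUnit_of_ev_ne_zero (hspan 1 0 H.nabla_one_zero), isUnit_of_ev_ne_zero fun h0 => H.gamma_ne ?_⟩
  obtain ⟨Ω, -, hu, hS⟩ := H.completion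
  have hN : ∀ i j : Fin 2, nabla (R i) (R j) ubar =
      ∑ k, christoffel ![R 0, R 1, s] k i.castSucc j.castSucc ubar • ![R 0, R 1, s] k ubar := by
    intro i j
    rw [← nabla_eq_sum_christoffel hS hu]
    fin_cases i <;> fin_cases j <;> rfl
  have hind := hS.independent ubar hu
  -- the coefficients along `s` and along the bracket differ by a factor independent of `i`, `j`
  have hL : VectorField.lieBracket ℝ (R 0) (R 1) ubar =
      nabla (R 0) (R 1) ubar - nabla (R 1) (R 0) ubar := rfl
  have key : ∀ i j : Fin 2, christoffel ![R 0, R 1, s] 2 i.castSucc j.castSucc ubar =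
      ev ubar ((bracketFrame _ _ H.isUnit_det).G i.castSucc j.castSucc 2) *
        (christoffel ![R 0, R 1, s] 2 0 1 ubar - christoffel ![R 0, R 1, s] 2 1 0 ubar) := by
    intro i j
    have h := H.nabla_eq_sum i j
    set g := fun k => ev ubar ((bracketFrame _ _ H.isUnit_det).G i.castSucc j.castSucc k) with hg
    set C := fun k i j => christoffel ![R 0, R 1, s] k i j ubar with hC
    have hlin := Fintype.linearIndependent_iff.1 hind
      ![C 0 i.castSucc j.castSucc - g 0 - g 2 * (C 0 0 1 - C 0 1 0),
        C 1 i.castSucc j.castSucc - g 1 - g 2 * (C 1 0 1 - C 1 1 0),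
        C 2 i.castSucc j.castSucc - g 2 * (C 2 0 1 - C 2 1 0)] (by
          funext m
          have h1 := h m
          have h2 := congrFun hL m
          have h3 := congrFun (hN i j) m
          have h4 := congrFun (hN 0 1) m
          have h5 := congrFun (hN 1 0) m
          simp only [Fin.sum_univ_three, Finset.sum_apply, Pi.smul_apply,
            Matrix.cons_val, smul_eq_mul, Pi.sub_apply, Pi.zero_apply, Fin.castSucc_zero,
            Fin.castSucc_one, hg, hC] at h1 h2 h3 h4 h5 ⊢
          rw [h3, h2, h4, h5] at h1
          linear_combination h1) 2
    simpa [sub_eq_zero] using hlin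
  have k01 := key 0 1
  have k10 := key 1 0
  have k00 := key 0 0
  have k11 := key 1 1
  simp only [Fin.castSucc_zero, Fin.castSucc_one] at k01 k10 k00 k11
  simp only [map_sub, map_mul, map_ofNat] at h0
  rw [k11, k00]
  set θ := christoffel ![R 0, R 1, s] 2 0 1 ubar - christoffel ![R 0, R 1, s] 2 1 0 ubar
  linear_combination θ ^ 2 * h0 - 9 * christoffel ![R 0, R 1, s] 2 0 1 ubar * k10
    - 9 * ev ubar ((bracketFrame _ _ H.isUnit_det).G 1 0 2) * θ * k01

end SizeHypotheses

/-! ### The dimension of the quotient -/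

section Rank

variable {𝕜 V W : Type} [Field 𝕜] [AddCommGroup V] [Module 𝕜 V] [AddCommGroup W] [Module 𝕜 W]

/-- If a linear relation between `V` and `W` relates every vector of `V` to some vector of `W`, and
relates to `0` only vectors of the subspace `T`, then `V / T` has at most the dimension of `W`. -/
theorem rank_quotient_le_of_relation (T : Submodule 𝕜 V) (Q : Submodule 𝕜 (V × W))
    (hV : ∀ v, ∃ w, (v, w) ∈ Q) (hT : ∀ v, (v, 0) ∈ Q → v ∈ T) :
    Module.rank 𝕜 (V ⧸ T) ≤ Module.rank 𝕜 W := by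
  let f : Q →ₗ[𝕜] V ⧸ T := T.mkQ ∘ₗ LinearMap.fst 𝕜 V W ∘ₗ Q.subtype
  let g : Q →ₗ[𝕜] W := LinearMap.snd 𝕜 V W ∘ₗ Q.subtype
  have hf : Function.Surjective f := by
    intro y
    obtain ⟨v, rfl⟩ := T.mkQ_surjective y
    obtain ⟨w, hw⟩ := hV v
    exact ⟨⟨(v, w), hw⟩, rfl⟩
  have hker : LinearMap.ker g ≤ LinearMap.ker f := by
    rintro ⟨⟨v, w⟩, hq⟩ h
    obtain rfl : w = 0 := h
    exact (Submodule.Quotient.mk_eq_zero T).2 (hT v hq)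
  have h1 : Function.Surjective ((LinearMap.ker g).liftQ f hker) := by
    intro y
    obtain ⟨q, hq⟩ := hf y
    exact ⟨(LinearMap.ker g).mkQ q, hq⟩
  calc Module.rank 𝕜 (V ⧸ T)
    _ ≤ Module.rank 𝕜 (Q ⧸ LinearMap.ker g) := LinearMap.rank_le_of_surjective _ h1
    _ = Module.rank 𝕜 (LinearMap.range g) := g.quotKerEquivRange.rank_eq
    _ ≤ Module.rank 𝕜 W := Submodule.rank_le _

/-- If moreover every vector of `W` is related to a vector of `V`, and vectors of `T` are related
to `0` only, the dimensions are equal. -/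
theorem rank_quotient_eq_of_relation (T : Submodule 𝕜 V) (Q : Submodule 𝕜 (V × W))
    (hV : ∀ v, ∃ w, (v, w) ∈ Q) (hT : ∀ v, (v, 0) ∈ Q → v ∈ T) (hW : ∀ w, ∃ v, (v, w) ∈ Q)
    (hT' : ∀ v w, v ∈ T → (v, w) ∈ Q → w = 0) :
    Module.rank 𝕜 (V ⧸ T) = Module.rank 𝕜 W := by
  refine (rank_quotient_le_of_relation T Q hV hT).antisymm ?_
  let f : Q →ₗ[𝕜] V ⧸ T := T.mkQ ∘ₗ LinearMap.fst 𝕜 V W ∘ₗ Q.subtype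
  let g : Q →ₗ[𝕜] W := LinearMap.snd 𝕜 V W ∘ₗ Q.subtype
  have hg : Function.Surjective g := by
    intro w
    obtain ⟨v, hv⟩ := hW w
    exact ⟨⟨(v, w), hv⟩, rfl⟩
  have hker : LinearMap.ker f ≤ LinearMap.ker g := by
    rintro ⟨⟨v, w⟩, hq⟩ h
    exact hT' v w ((Submodule.Quotient.mk_eq_zero T).1 h) hq
  have h1 : Function.Surjective ((LinearMap.ker f).liftQ g hker) := by
    intro y
    obtain ⟨q, hq⟩ := hg y
    exact ⟨(LinearMap.ker f).mkQ q, hq⟩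
  calc Module.rank 𝕜 W
    _ ≤ Module.rank 𝕜 (Q ⧸ LinearMap.ker f) := LinearMap.rank_le_of_surjective _ h1
    _ = Module.rank 𝕜 (LinearMap.range f) := f.quotKerEquivRange.rank_eq
    _ ≤ Module.rank 𝕜 (V ⧸ T) := Submodule.rank_le _

end Rank

section FluxRelation

variable {x : Fin 3 → ℝ} {r : Fin 2 → Fin 3 → SmoothGerm x}

theorem IsGermFlux.add {F G : Fin 3 → SmoothGerm x} {l m : Fin 2 → SmoothGerm x}
    (hF : IsGermFlux r F l) (hG : IsGermFlux r G m) : IsGermFlux r (F + G) (l + m) := by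
  intro i k
  rw [Pi.add_apply, map_add, hF, hG, Pi.add_apply, add_mul]

theorem IsGermFlux.const_mul {F : Fin 3 → SmoothGerm x} {l : Fin 2 → SmoothGerm x} (c : ℝ)
    (hF : IsGermFlux r F l) :
    IsGermFlux r (fun k => const x c * F k) (fun i => const x c * l i) := by
  intro i k
  rw [Derivation.leibniz, hF, along_const, smul_zero, add_zero, smul_eq_mul, mul_assoc]

theorem fluxJet_add (l m : Fin 2 → SmoothGerm x) :
    fluxJet r (l + m) = fluxJet r l + fluxJet r m := by
  funext j
  fin_cases j <;> (simp [fluxJet]; try ring)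

theorem fluxJet_const_mul (c : ℝ) (l : Fin 2 → SmoothGerm x) :
    fluxJet r (fun i => const x c * l i) = c • fluxJet r l := by
  funext j
  fin_cases j <;> (simp [fluxJet]; try ring)

/-- The relation between flux germs and selected components of their jets.  Working with a
relation avoids choosing the eigenvalues of a flux germ. -/
noncomputable def fluxRelation (r : Fin 2 → Fin 3 → SmoothGerm x)
    (V : Submodule ℝ (Germ (𝓝 x) (Fin 3 → ℝ))) {k : ℕ} (σ : Fin k → Fin 4) :
    Submodule ℝ (V × (Fin k → ℝ)) where
  carrier := {q | ∃ (F : Fin 3 → SmoothGerm x) (l : Fin 2 → SmoothGerm x),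
    IsGermFlux r F l ∧ (q.1 : Germ (𝓝 x) (Fin 3 → ℝ)) = toGerm F ∧ q.2 = fluxJet r l ∘ σ}
  zero_mem' := by
    refine ⟨fun k => const x 0 * 0, fun i => const x 0 * 0,
      IsGermFlux.const_mul 0 (F := 0) (l := 0) fun i k => by simp, ?_, ?_⟩
    · exact ((toGerm_const_mul 0 0).trans (zero_smul _ _)).symm
    · exact (congrArg (· ∘ σ) ((fluxJet_const_mul 0 0).trans (zero_smul _ _))).symm
  add_mem' := by
    rintro ⟨v, y⟩ ⟨w, z⟩ ⟨F, l, hF, h1, h2⟩ ⟨G, m, hG, h3, h4⟩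
    refine ⟨F + G, l + m, hF.add hG, ?_, ?_⟩
    · rw [toGerm_add, ← h1, ← h3]
      rfl
    · rw [fluxJet_add]
      change y + z = _
      rw [show y = _ from h2, show z = _ from h4]
      rfl
  smul_mem' := by
    rintro c ⟨v, y⟩ ⟨F, l, hF, h1, h2⟩
    refine ⟨_, _, hF.const_mul c, ?_, ?_⟩
    · rw [toGerm_const_mul, ← h1]
      rfl
    · rw [fluxJet_const_mul]
      change c • y = _
      rw [show y = _ from h2]
      rfl

end FluxRelation

namespace SizeHypotheses

variable {ubar : Fin 3 → ℝ} {R : Fin 2 → VField 3} {s : VField 3}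

theorem exists_mem_fluxRelation (H : SizeHypotheses ubar R s) {k : ℕ} (σ : Fin k → Fin 4)
    (v : fluxSpace R ubar) : ∃ w, (v, w) ∈ fluxRelation H.germ (fluxSpace R ubar) σ := by
  obtain ⟨F, l, hF, h⟩ := (mem_fluxSpace_iff H.eventually_contDiffAt _).1 v.2
  exact ⟨_, F, l, hF, h, rfl⟩

/-- A flux is trivial if its jet at the base point vanishes. -/
theorem toGerm_mem_trivialFluxes (H : SizeHypotheses ubar R s) {F : Fin 3 → SmoothGerm ubar}
    {l : Fin 2 → SmoothGerm ubar} (hF : IsGermFlux H.germ F l) (h0 : fluxJet H.germ l = 0) :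
    toGerm F ∈ trivialFluxes ubar := by
  obtain ⟨hα, hβ, hδ⟩ := H.units
  exact (mem_trivialFluxes_iff F).2 (hF.exists_eq_of_fluxJet_eq_zero H.isUnit_det hα hβ hδ h0)

theorem rank_fluxQuotient_le (H : SizeHypotheses ubar R s) :
    Module.rank ℝ (FluxQuotient R ubar) ≤ 4 := by
  have h := rank_quotient_le_of_relation ((trivialFluxes ubar).submoduleOf (fluxSpace R ubar))
    (fluxRelation H.germ (fluxSpace R ubar) (id : Fin 4 → Fin 4)) (H.exists_mem_fluxRelation id) (by
      rintro v ⟨F, l, hF, h1, h2⟩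
      refine Submodule.mem_comap.2 ?_
      change (v : Germ (𝓝 ubar) (Fin 3 → ℝ)) ∈ _
      rw [h1]
      exact H.toGerm_mem_trivialFluxes hF h2.symm)
  simpa using h

/-- The eigenvalues of a trivial flux are equal constants. -/
theorem eigenvalue_eq_const (H : SizeHypotheses ubar R s) {F : Fin 3 → SmoothGerm ubar}
    {l : Fin 2 → SmoothGerm ubar} (hF : IsGermFlux H.germ F l) {c : ℝ} {a : Fin 3 → ℝ}
    (h : ∀ k, F k = const ubar c * coord ubar k + const ubar (a k)) (i : Fin 2) :
    l i = const ubar c := by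
  have h1 : ∀ k, (l i - const ubar c) * H.germ i k = 0 := by
    intro k
    have h2 := hF i k
    rw [h k] at h2
    simp only [map_add, Derivation.leibniz, along_const, along_coord, smul_eq_mul] at h2
    linear_combination -h2
  have h3 := (bracketFrame _ _ H.isUnit_det).independent
    (Pi.single i.castSucc (l i - const ubar c)) (fun m => by
      rw [Finset.sum_eq_single i.castSucc (fun j _ hj => by simp [Pi.single_eq_of_ne hj])
        (by simp), Pi.single_eq_same]
      refine Eq.trans ?_ (h1 m)
      fin_cases i <;> rfl) i.castSucc
  rw [Pi.single_eq_same] at h3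
  exact sub_eq_zero.1 h3

/-- The dimension of the quotient is `k` if `k` of the components of the jet of a flux determine
the others, and fluxes with arbitrary values of these components exist. -/
theorem rank_fluxQuotient_eq (H : SizeHypotheses ubar R s) {k : ℕ} (σ : Fin k → Fin 4)
    (h0 : ∀ F l, IsGermFlux H.germ F l → (∀ j, fluxJet H.germ l (σ j) = 0) →
      fluxJet H.germ l = 0)
    (F : Fin k → Fin 3 → SmoothGerm ubar) (l : Fin k → Fin 2 → SmoothGerm ubar)
    (hF : ∀ j, IsGermFlux H.germ (F j) (l j))
    (hj : ∀ w : Fin k → ℝ, ∃ c : Fin k → ℝ,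
      ∀ j, ∑ i, c i * fluxJet H.germ (l i) (σ j) = w j) :
    Module.rank ℝ (FluxQuotient R ubar) = (k : Cardinal) := by
  have h := rank_quotient_eq_of_relation ((trivialFluxes ubar).submoduleOf (fluxSpace R ubar))
    (fluxRelation H.germ (fluxSpace R ubar) σ) (H.exists_mem_fluxRelation σ) ?_ ?_ ?_
  · simpa using h
  · rintro v ⟨F, l, hF, h1, h2⟩
    refine Submodule.mem_comap.2 ?_
    change (v : Germ (𝓝 ubar) (Fin 3 → ℝ)) ∈ _
    rw [h1]
    exact H.toGerm_mem_trivialFluxes hF (h0 F l hF fun j => (congrFun h2 j).symm)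
  · intro w
    have hmem : ∀ j, ∃ v, (v, fluxJet H.germ (l j) ∘ σ) ∈
        fluxRelation H.germ (fluxSpace R ubar) σ := fun j =>
      ⟨⟨toGerm (F j), (mem_fluxSpace_iff H.eventually_contDiffAt _).2
        ⟨F j, l j, hF j, rfl⟩⟩, F j, l j, hF j, rfl, rfl⟩
    choose v hv using hmem
    obtain ⟨c, hc⟩ := hj w
    refine ⟨∑ j, c j • v j, ?_⟩
    have hs := Submodule.sum_mem _ fun j (_ : j ∈ Finset.univ) =>
      Submodule.smul_mem _ (c j) (hv j)
    convert hs using 1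
    refine Prod.ext ?_ ?_
    · simp [Prod.fst_sum]
    · rw [Prod.snd_sum]
      funext i
      simp [← hc i]
  · rintro v w hv ⟨F, l, hF, h1, h2⟩
    replace hv : (v : Germ (𝓝 ubar) (Fin 3 → ℝ)) ∈ trivialFluxes ubar := hv
    rw [h1] at hv
    obtain ⟨c, a, h⟩ := (mem_trivialFluxes_iff F).1 hv
    have hl : l = fun _ => const ubar c := funext fun i => H.eigenvalue_eq_const hF h i
    have hz : fluxJet H.germ l = 0 := by
      funext j
      rw [hl]
      fin_cases j <;> simp [fluxJet]
    rw [show w = _ from h2, hz]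
    rfl

end SizeHypotheses

/-! ### Fluxes of two fields with central bracket -/

theorem derivation_ofNat {A : Type*} [CommRing A] (D : Derivation ℤ A A) (n : ℕ) [n.AtLeastTwo] :
    D (ofNat(n) : A) = 0 :=
  D.map_natCast n

/-- The scalar data of a flux `(f, g, h)` with eigenvalues `l`, `m` for the vector fields
`(1, 0, a)` and `(0, 1, b)`, when `a` and `b` do not depend on the third coordinate and the bracket
of the two fields is the third coordinate field: `d₀`, `d₁`, `Z` are the derivations along the
two fields and along their bracket, which is central. -/
structure CentralFlux (A : Type*) [CommRing A] where
  d₀ : Derivation ℤ A A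
  d₁ : Derivation ℤ A A
  Z : Derivation ℤ A A
  Z_eq : ∀ φ, Z φ = d₀ (d₁ φ) - d₁ (d₀ φ)
  Z_d₀ : ∀ φ, Z (d₀ φ) = d₀ (Z φ)
  Z_d₁ : ∀ φ, Z (d₁ φ) = d₁ (Z φ)
  a : A
  b : A
  Z_a : Z a = 0
  Z_b : Z b = 0
  d₀_b : d₀ b = d₁ a + 1
  f : A
  g : A
  h : A
  l : A
  m : A
  d₀_f : d₀ f = l
  d₁_f : d₁ f = 0
  d₀_g : d₀ g = 0
  d₁_g : d₁ g = m
  d₀_h : d₀ h = l * a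
  d₁_h : d₁ h = m * b

namespace CentralFlux

variable {A : Type*} [CommRing A] (Φ : CentralFlux A)

/-- The derivative of the first eigenvalue along the second field. -/
def p : A := Φ.d₁ Φ.l

/-- The derivative of the second eigenvalue along the first field. -/
def q : A := Φ.d₀ Φ.m

/-- The second derivative `d₀ d₁` of the first eigenvalue. -/
def t : A := Φ.d₀ Φ.p

/-- The second derivative `d₁ d₀` of the second eigenvalue. -/
def r : A := Φ.d₁ Φ.q

theorem d₁_l : Φ.d₁ Φ.l = Φ.p := rfl

theorem d₀_m : Φ.d₀ Φ.m = Φ.q := rfl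

theorem d₀_p : Φ.d₀ Φ.p = Φ.t := rfl

theorem d₁_q : Φ.d₁ Φ.q = Φ.r := rfl

/-! In the following lemmas, `[Z, d₀] = [Z, d₁] = 0` is applied to `f`, `g` and `h`. The components
`f` and `g` give the second derivatives of the eigenvalues that vanish and commutation rules for
the higher ones; `h` gives two first-order equations `d₀_l`, `d₁_m`, which are then differentiated.
-/

theorem Z_f : Φ.Z Φ.f = -Φ.p := by
  rw [Φ.Z_eq, Φ.d₁_f, Φ.d₀_f, map_zero, zero_sub, p]

theorem Z_g : Φ.Z Φ.g = Φ.q := by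
  rw [Φ.Z_eq, Φ.d₁_g, Φ.d₀_g, map_zero, sub_zero, q]

theorem d₁_p : Φ.d₁ Φ.p = 0 := by
  have h := Φ.Z_d₁ Φ.f
  rw [Φ.d₁_f, Φ.Z_f, map_zero, map_neg] at h
  exact neg_eq_zero.1 h.symm

theorem d₀_q : Φ.d₀ Φ.q = 0 := by
  have h := Φ.Z_d₀ Φ.g
  rw [Φ.d₀_g, Φ.Z_g, map_zero] at h
  exact h.symm

theorem Z_l : Φ.Z Φ.l = -Φ.t := by
  have h := Φ.Z_d₀ Φ.f
  rwa [Φ.d₀_f, Φ.Z_f, map_neg] at h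

theorem Z_m : Φ.Z Φ.m = Φ.r := by
  have h := Φ.Z_d₁ Φ.g
  rwa [Φ.d₁_g, Φ.Z_g] at h

theorem d₁_d₀_l : Φ.d₁ (Φ.d₀ Φ.l) = 2 * Φ.t := by
  have h := Φ.Z_eq Φ.l
  rw [Φ.Z_l] at h
  change -Φ.t = Φ.t - _ at h
  linear_combination h

theorem d₀_d₁_m : Φ.d₀ (Φ.d₁ Φ.m) = 2 * Φ.r := by
  have h := Φ.Z_eq Φ.m
  rw [Φ.Z_m] at h
  change Φ.r = _ - Φ.r at h
  linear_combination -h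

theorem Z_p : Φ.Z Φ.p = -Φ.d₁ Φ.t := by
  rw [Φ.Z_eq, Φ.d₁_p, map_zero, zero_sub, t]

theorem Z_q : Φ.Z Φ.q = Φ.d₀ Φ.r := by
  rw [Φ.Z_eq, Φ.d₀_q, map_zero, sub_zero, r]

theorem d₁_d₁_t : Φ.d₁ (Φ.d₁ Φ.t) = 0 := by
  have h := Φ.Z_d₁ Φ.p
  rw [Φ.d₁_p, Φ.Z_p, map_zero, map_neg] at h
  exact neg_eq_zero.1 h.symm

theorem d₀_d₀_r : Φ.d₀ (Φ.d₀ Φ.r) = 0 := by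
  have h := Φ.Z_d₀ Φ.q
  rw [Φ.d₀_q, Φ.Z_q, map_zero] at h
  exact h.symm

theorem d₁_d₀_t : Φ.d₁ (Φ.d₀ Φ.t) = 2 * Φ.d₀ (Φ.d₁ Φ.t) := by
  have h := Φ.Z_d₀ Φ.p
  rw [Φ.Z_p, ← t, Φ.Z_eq, map_neg] at h
  linear_combination -h

theorem d₀_d₁_r : Φ.d₀ (Φ.d₁ Φ.r) = 2 * Φ.d₁ (Φ.d₀ Φ.r) := by
  have h := Φ.Z_d₁ Φ.q
  rw [Φ.Z_q, ← r, Φ.Z_eq] at h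
  linear_combination h

theorem d₁_d₀_d₀_l : Φ.d₁ (Φ.d₀ (Φ.d₀ Φ.l)) = 3 * Φ.d₀ Φ.t := by
  have h := Φ.Z_d₀ Φ.l
  rw [Φ.Z_eq, Φ.Z_l, map_neg, Φ.d₁_d₀_l, Derivation.leibniz, derivation_ofNat, smul_eq_mul,
    smul_zero] at h
  linear_combination -h

theorem d₀_d₁_d₁_m : Φ.d₀ (Φ.d₁ (Φ.d₁ Φ.m)) = 3 * Φ.d₁ Φ.r := by
  have h := Φ.Z_d₁ Φ.m
  rw [Φ.Z_eq, Φ.Z_m, Φ.d₀_d₁_m, Derivation.leibniz, derivation_ofNat, smul_eq_mul,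
    smul_zero] at h
  linear_combination h

theorem d₀_d₁_d₁_r : Φ.d₀ (Φ.d₁ (Φ.d₁ Φ.r)) = 3 * Φ.d₁ (Φ.d₁ (Φ.d₀ Φ.r)) := by
  have h := Φ.Z_d₁ Φ.r
  rw [Φ.Z_eq, Φ.Z_eq, map_sub, Φ.d₀_d₁_r, Derivation.leibniz, derivation_ofNat, smul_eq_mul,
    smul_zero] at h
  linear_combination h

theorem d₁_d₀_a : Φ.d₁ (Φ.d₀ Φ.a) = Φ.d₀ (Φ.d₁ Φ.a) := by
  have h := Φ.Z_eq Φ.a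
  rw [Φ.Z_a] at h
  linear_combination h

theorem Z_h : Φ.Z Φ.h = Φ.q * Φ.b + Φ.m * (Φ.d₁ Φ.a + 1) - Φ.p * Φ.a - Φ.l * Φ.d₁ Φ.a := by
  rw [Φ.Z_eq, Φ.d₁_h, Φ.d₀_h]
  simp only [Derivation.leibniz, smul_eq_mul, Φ.d₀_b, p, q]
  ring

/-- The equation `Z d₀ h = d₀ Z h`. -/
theorem d₀_l : Φ.d₁ Φ.a * Φ.d₀ Φ.l =
    2 * (Φ.d₁ Φ.a + 1) * Φ.q - Φ.d₀ Φ.a * Φ.p + (Φ.m - Φ.l) * Φ.d₀ (Φ.d₁ Φ.a) := by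
  have h := Φ.Z_d₀ Φ.h
  rw [Φ.d₀_h, Φ.Z_h] at h
  simp only [Derivation.leibniz, smul_eq_mul, map_add, map_sub, Φ.d₀_b, Φ.Z_a, Φ.Z_l, Φ.d₀_q,
    Derivation.map_one_eq_zero, Φ.d₀_m, Φ.d₀_p] at h
  linear_combination h

/-- The equation `Z d₁ h = d₁ Z h`. -/
theorem d₁_m : (Φ.d₁ Φ.a + 1) * Φ.d₁ Φ.m =
    2 * Φ.d₁ Φ.a * Φ.p - Φ.d₁ Φ.b * Φ.q - (Φ.m - Φ.l) * Φ.d₁ (Φ.d₁ Φ.a) := by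
  have h := Φ.Z_d₁ Φ.h
  rw [Φ.d₁_h, Φ.Z_h] at h
  simp only [Derivation.leibniz, smul_eq_mul, map_add, map_sub, Φ.Z_b, Φ.Z_m, Φ.d₁_p,
    Derivation.map_one_eq_zero, Φ.d₁_l, Φ.d₁_q] at h
  linear_combination -h

/-- The derivative of `CentralFlux.d₀_l` along the bracket. -/
theorem d₀_t : -(Φ.d₁ Φ.a * Φ.d₀ Φ.t) = 2 * (Φ.d₁ Φ.a + 1) * Φ.d₀ Φ.r
    + Φ.d₀ Φ.a * Φ.d₁ Φ.t + (Φ.r + Φ.t) * Φ.d₀ (Φ.d₁ Φ.a) := by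
  have h := congrArg Φ.Z Φ.d₀_l
  simp only [Derivation.leibniz, smul_eq_mul, map_add, map_sub, Φ.Z_d₀, Φ.Z_d₁, Φ.Z_a, Φ.Z_l,
    Φ.Z_m, Φ.Z_p, Φ.Z_q, map_zero, map_neg, Derivation.map_one_eq_zero, derivation_ofNat] at h
  linear_combination h

/-- The derivative of `CentralFlux.d₁_m` along the bracket. -/
theorem d₁_r : (Φ.d₁ Φ.a + 1) * Φ.d₁ Φ.r = -(2 * Φ.d₁ Φ.a * Φ.d₁ Φ.t)
    - Φ.d₁ Φ.b * Φ.d₀ Φ.r - (Φ.r + Φ.t) * Φ.d₁ (Φ.d₁ Φ.a) := by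
  have h := congrArg Φ.Z Φ.d₁_m
  simp only [Derivation.leibniz, smul_eq_mul, map_add, map_sub, Φ.Z_d₁, Φ.Z_a, Φ.Z_b, Φ.Z_l,
    Φ.Z_m, Φ.Z_p, Φ.Z_q, map_zero, Derivation.map_one_eq_zero, derivation_ofNat] at h
  linear_combination h

/-- The derivative of `CentralFlux.d₀_l` along the second field: a relation between the second
derivatives `t` and `r` of the eigenvalues. -/
theorem t_r_relation : Φ.d₁ (Φ.d₁ Φ.a) * Φ.d₀ Φ.l + 2 * Φ.d₁ Φ.a * Φ.t =
    2 * Φ.d₁ (Φ.d₁ Φ.a) * Φ.q + 2 * (Φ.d₁ Φ.a + 1) * Φ.r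
      + (Φ.d₁ Φ.m - 2 * Φ.p) * Φ.d₀ (Φ.d₁ Φ.a) + (Φ.m - Φ.l) * Φ.d₁ (Φ.d₀ (Φ.d₁ Φ.a)) := by
  have h := congrArg Φ.d₁ Φ.d₀_l
  simp only [Derivation.leibniz, smul_eq_mul, map_add, map_sub, Φ.d₁_d₀_a, Φ.d₁_d₀_l, Φ.d₁_p,
    Derivation.map_one_eq_zero, derivation_ofNat, Φ.d₁_l, Φ.d₁_q] at h
  linear_combination h

end CentralFlux

/-! ### The vector fields (1, 0, a) and (0, 1, b) -/

section Graph

variable {x : Fin 3 → ℝ}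

/-- The vector fields `(1, 0, a)` and `(0, 1, b)`. -/
noncomputable def graphField (a b : SmoothGerm x) : Fin 2 → VField 3 :=
  ![fun u => ![1, 0, rep a u], fun u => ![0, 1, rep b u]]

/-- The germs of the vector fields `(1, 0, a)` and `(0, 1, b)`. -/
def graphGerm (a b : SmoothGerm x) : Fin 2 → Fin 3 → SmoothGerm x := ![![1, 0, a], ![0, 1, b]]

/-- The field of the third coordinate. -/
def verticalField : VField 3 := fun _ => ![0, 0, 1]

theorem contDiffAt_graphField {a b : SmoothGerm x} {u : Fin 3 → ℝ}
    (ha : ContDiffAt ℝ ∞ (rep a) u) (hb : ContDiffAt ℝ ∞ (rep b) u) (i : Fin 2) :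
    ContDiffAt ℝ ∞ (graphField a b i) u := by
  refine contDiffAt_pi.2 fun k => ?_
  fin_cases i <;> fin_cases k
  exacts [contDiffAt_const, contDiffAt_const, ha, contDiffAt_const, contDiffAt_const, hb]

theorem eventually_contDiffAt_graphField (a b : SmoothGerm x) (i : Fin 2) :
    ∀ᶠ u in 𝓝 x, ContDiffAt ℝ ∞ (graphField a b i) u := by
  filter_upwards [rep_smooth a, rep_smooth b] with u ha hb using contDiffAt_graphField ha hb i

theorem ofField_graphField (a b : SmoothGerm x) (i : Fin 2) :
    ofField (graphField a b i) (eventually_contDiffAt_graphField a b i) = graphGerm a b i := by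
  funext k
  fin_cases i <;> fin_cases k
  exacts [rfl, rfl, mk_rep a, rfl, rfl, mk_rep b]

theorem along_graphGerm (a b φ : SmoothGerm x) :
    along (graphGerm a b 0) φ = pd x 0 φ + a * pd x 2 φ ∧
      along (graphGerm a b 1) φ = pd x 1 φ + b * pd x 2 φ := by
  constructor <;> simp [along_apply, Fin.sum_univ_three, graphGerm]

theorem nabla_graphField (a b : SmoothGerm x) (i j : Fin 2) :
    nabla (graphField a b i) (graphField a b j) x =
      ![0, 0, ev x (along (graphGerm a b i) (graphGerm a b j 2))] := by
  funext k
  have h := along_ofField (eventually_contDiffAt_graphField a b i)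
    (eventually_contDiffAt_graphField a b j) k
  rw [ofField_graphField, ofField_graphField] at h
  have h2 := congrArg (ev x) h
  rw [ev_ofField] at h2
  rw [← h2]
  fin_cases j <;> fin_cases k <;> simp [graphGerm]

theorem sizeHypotheses_graphField {a b : SmoothGerm x} (ha : pd x 2 a = 0) (hb : pd x 2 b = 0)
    (hab : pd x 0 b = pd x 1 a + 1) (h1 : ev x (pd x 1 a) ≠ 0) (h2 : ev x (pd x 1 a) + 1 ≠ 0)
    (h3 : ev x (pd x 1 b) * ev x (pd x 0 a) - 9 * (ev x (pd x 1 a) + 1) * ev x (pd x 1 a) ≠ 0) :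
    SizeHypotheses x (graphField a b) verticalField := by
  obtain ⟨Ω, hΩ, ho, hx⟩ := eventually_nhds_iff.1 ((rep_smooth a).and (rep_smooth b))
  have hsm : ∀ i, ContDiffOn ℝ ∞ (graphField a b i) Ω := fun i u hu =>
    (contDiffAt_graphField (hΩ u hu).1 (hΩ u hu).2 i).contDiffWithinAt
  have hspan : ∀ c : ℝ, c ≠ 0 → (![0, 0, c] : Fin 3 → ℝ) ∉
      Submodule.span ℝ {graphField a b 0 x, graphField a b 1 x} := by
    intro c hc h
    obtain ⟨y, z, h⟩ := Submodule.mem_span_pair.1 h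
    have e0 := congrFun h 0
    have e1 := congrFun h 1
    have e2 := congrFun h 2
    simp [graphField] at e0 e1 e2
    exact hc (by rw [← e2, e0, e1]; ring)
  have n00 : nabla (graphField a b 0) (graphField a b 0) x = ![0, 0, ev x (pd x 0 a)] := by
    rw [nabla_graphField, (along_graphGerm a b _).1]
    simp [graphGerm, ha]
  have n01 : nabla (graphField a b 0) (graphField a b 1) x = ![0, 0, ev x (pd x 1 a) + 1] := by
    rw [nabla_graphField, (along_graphGerm a b _).1]
    simp [graphGerm, hb, hab]
  have n10 : nabla (graphField a b 1) (graphField a b 0) x = ![0, 0, ev x (pd x 1 a)] := by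
    rw [nabla_graphField, (along_graphGerm a b _).2]
    simp [graphGerm, ha]
  have n11 : nabla (graphField a b 1) (graphField a b 1) x = ![0, 0, ev x (pd x 1 b)] := by
    rw [nabla_graphField, (along_graphGerm a b _).2]
    simp [graphGerm, hb]
  have hframe : IsPartialFrame Ω ![graphField a b 0, graphField a b 1, verticalField] := by
    constructor
    · intro i
      fin_cases i
      exacts [hsm 0, hsm 1, contDiffOn_const]
    · intro u _
      refine Fintype.linearIndependent_iff.2 fun g hg => ?_
      have e0 := congrFun hg 0
      have e1 := congrFun hg 1
      have e2 := congrFun hg 2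
      simp [Fin.sum_univ_three, graphField, verticalField] at e0 e1 e2
      simp only [e0, e1, zero_mul, zero_add] at e2
      intro i
      fin_cases i
      exacts [e0, e1, e2]
  have hch : ∀ i j : Fin 2, christoffel ![graphField a b 0, graphField a b 1, verticalField]
      2 i.castSucc j.castSucc x = nabla (graphField a b i) (graphField a b j) x 2 := by
    intro i j
    have h := nabla_eq_sum_christoffel hframe hx i.castSucc j.castSucc
    have hn : nabla (![graphField a b 0, graphField a b 1, verticalField] i.castSucc)
        (![graphField a b 0, graphField a b 1, verticalField] j.castSucc) x =
        nabla (graphField a b i) (graphField a b j) x := by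
      fin_cases i <;> fin_cases j <;> rfl
    rw [hn] at h
    have e0 := congrFun h 0
    have e1 := congrFun h 1
    have e2 := congrFun h 2
    rw [nabla_graphField] at e0 e1
    simp [Fin.sum_univ_three, graphField, verticalField] at e0 e1 e2
    rw [← e0, ← e1] at e2
    simpa [graphField] using e2.symm
  refine ⟨⟨Ω, ho, hx, hsm, fun u _ => ?_⟩, ?_, ?_, ?_, ⟨Ω, ho, hx, hframe⟩, ?_⟩
  · refine Fintype.linearIndependent_iff.2 fun g hg => ?_
    have e0 := congrFun hg 0
    have e1 := congrFun hg 1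
    simp [graphField] at e0 e1
    intro i
    fin_cases i
    exacts [e0, e1]
  · have : VectorField.lieBracket ℝ (graphField a b 0) (graphField a b 1) x = ![0, 0, 1] := by
      change nabla _ _ x - nabla _ _ x = _
      rw [n01, n10]
      simp
    rw [this]
    exact hspan 1 one_ne_zero
  · rw [n01]
    exact hspan _ h2
  · rw [n10]
    exact hspan _ h1
  · have k00 := hch 0 0
    have k01 := hch 0 1
    have k10 := hch 1 0
    have k11 := hch 1 1
    rw [n00] at k00
    rw [n01] at k01
    rw [n10] at k10
    rw [n11] at k11
    simp only [Fin.castSucc_zero, Fin.castSucc_one, Matrix.cons_val] at k00 k01 k10 k11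
    rw [k00, k01, k10, k11]
    exact h3

/-- The scalar equations of a flux for the vector fields `(1, 0, a)` and `(0, 1, b)`. -/
noncomputable def centralFlux {a b : SmoothGerm x} (ha : pd x 2 a = 0) (hb : pd x 2 b = 0)
    (hab : pd x 0 b = pd x 1 a + 1) {F : Fin 3 → SmoothGerm x} {l : Fin 2 → SmoothGerm x}
    (hF : IsGermFlux (graphGerm a b) F l) : CentralFlux (SmoothGerm x) where
  d₀ := along (graphGerm a b 0)
  d₁ := along (graphGerm a b 1)
  Z := pd x 2
  Z_eq φ := by
    simp only [(along_graphGerm a b _).1, (along_graphGerm a b _).2, map_add, Derivation.leibniz,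
      smul_eq_mul, ha, hb, hab, pd_comm 1 0 φ, pd_comm 2 0 φ, pd_comm 2 1 φ]
    ring
  Z_d₀ φ := by
    simp only [(along_graphGerm a b _).1, map_add, Derivation.leibniz, smul_eq_mul, ha,
      pd_comm 2 0 φ]
    ring
  Z_d₁ φ := by
    simp only [(along_graphGerm a b _).2, map_add, Derivation.leibniz, smul_eq_mul, hb,
      pd_comm 2 1 φ]
    ring
  a := a
  b := b
  Z_a := ha
  Z_b := hb
  d₀_b := by rw [(along_graphGerm a b _).1, (along_graphGerm a b _).2, ha, hb, hab]; ring
  f := F 0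
  g := F 1
  h := F 2
  l := l 0
  m := l 1
  d₀_f := (hF 0 0).trans (mul_one _)
  d₁_f := (hF 1 0).trans (mul_zero _)
  d₀_g := (hF 0 1).trans (mul_zero _)
  d₁_g := (hF 1 1).trans (mul_one _)
  d₀_h := hF 0 2
  d₁_h := hF 1 2

theorem isGermFlux_graphGerm {a b f g h l m : SmoothGerm x}
    (h1 : pd x 0 f + a * pd x 2 f = l) (h2 : pd x 1 f + b * pd x 2 f = 0)
    (h3 : pd x 0 g + a * pd x 2 g = 0) (h4 : pd x 1 g + b * pd x 2 g = m)
    (h5 : pd x 0 h + a * pd x 2 h = l * a) (h6 : pd x 1 h + b * pd x 2 h = m * b) :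
    IsGermFlux (graphGerm a b) ![f, g, h] ![l, m] := by
  intro i k
  fin_cases i
  · refine (along_graphGerm a b _).1.trans ?_
    fin_cases k
    exacts [h1.trans (mul_one _).symm, h3.trans (mul_zero _).symm, h5]
  · refine (along_graphGerm a b _).2.trans ?_
    fin_cases k
    exacts [h2.trans (mul_zero _).symm, h4.trans (mul_one _).symm, h6]

/-- The jet `fluxJet` of a flux for the vector fields `(1, 0, a)` and `(0, 1, b)`. -/
noncomputable def CentralFlux.jet (Φ : CentralFlux (SmoothGerm x)) : Fin 4 → ℝ :=
  ![ev x (Φ.m - Φ.l), ev x Φ.p, ev x Φ.q, ev x Φ.t]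

/-- For the vector fields `(1, 0, a)` and `(0, 1, b)` the quotient has dimension `k` if the
components of the jet selected by `σ` determine the jet, and are attained arbitrarily on the span of
`k` given fluxes. -/
theorem exists_rank_eq {a b : SmoothGerm x} (ha : pd x 2 a = 0) (hb : pd x 2 b = 0)
    (hab : pd x 0 b = pd x 1 a + 1) (h1 : ev x (pd x 1 a) ≠ 0) (h2 : ev x (pd x 1 a) + 1 ≠ 0)
    (h3 : ev x (pd x 1 b) * ev x (pd x 0 a) - 9 * (ev x (pd x 1 a) + 1) * ev x (pd x 1 a) ≠ 0)
    {k : ℕ} (σ : Fin k → Fin 4)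
    (hσ : ∀ Φ : CentralFlux (SmoothGerm x), Φ.d₀ = along (graphGerm a b 0) →
      Φ.d₁ = along (graphGerm a b 1) → Φ.a = a → Φ.b = b → (∀ j, Φ.jet (σ j) = 0) → Φ.jet = 0)
    (F : Fin k → Fin 3 → SmoothGerm x) (l : Fin k → Fin 2 → SmoothGerm x)
    (hF : ∀ j, IsGermFlux (graphGerm a b) (F j) (l j))
    (hj : ∀ w : Fin k → ℝ, ∃ c : Fin k → ℝ,
      ∀ j, ∑ i, c i * fluxJet (graphGerm a b) (l i) (σ j) = w j) :
    ∃ (R : Fin 2 → VField 3) (s : VField 3), SizeHypotheses x R s ∧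
      Module.rank ℝ (FluxQuotient R x) = (k : Cardinal) := by
  have H := sizeHypotheses_graphField ha hb hab h1 h2 h3
  have hg : H.germ = graphGerm a b := funext fun i => ofField_graphField a b i
  refine ⟨_, _, H, H.rank_fluxQuotient_eq σ ?_ F l ?_ ?_⟩
  · rw [hg]
    intro F l hF h
    exact hσ (centralFlux ha hb hab hF) rfl rfl rfl rfl h
  · rwa [hg]
  · rwa [hg]

end Graph

/-! ### Conditions on the jet in particular cases -/

namespace CentralFlux

variable {A : Type*} [CommRing A] (Φ : CentralFlux A) (ε : A →+* ℝ) {X Y E : A}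

/-! In these lemmas `ε` stands for the evaluation at the base point, and `X`, `Y` for the first two
coordinates, centred there. Derivatives of the equations of a flux are evaluated, which gives a
system of linear equations over `ℝ` for the values of the eigenvalues and their derivatives. -/

/-- Two conditions on the jet for `a = (1 + 2 X) Y`, `b = 2 X + X²`. -/
theorem two_constraints (hX : ε X = 0) (hY : ε Y = 0) (x0 : Φ.d₀ X = 1) (x1 : Φ.d₁ X = 0)
    (y0 : Φ.d₀ Y = 0) (a1 : Φ.d₁ Φ.a = 1 + 2 * X) (a0 : Φ.d₀ Φ.a = 2 * Y) (b1 : Φ.d₁ Φ.b = 0) :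
    ε Φ.p = 0 ∧ ε Φ.t = 0 := by
  have e1 := Φ.t_r_relation
  have e2 := Φ.d₀_t
  have e3 := Φ.d₁_m
  simp only [a1, a0, b1, map_add, map_zero, Derivation.leibniz, smul_eq_mul, derivation_ofNat, x0,
    x1, Derivation.map_one_eq_zero] at e1 e2 e3
  have e4 := congrArg Φ.d₀ e1
  have e5 := congrArg Φ.d₀ e2
  simp only [map_add, map_sub, map_neg, map_zero, Derivation.leibniz, smul_eq_mul,
    derivation_ofNat, x0, y0, Derivation.map_one_eq_zero, Φ.d₀_p, Φ.d₀_q, Φ.d₀_d₁_m,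
    Φ.d₀_d₀_r] at e4 e5
  have e6 := congrArg Φ.d₀ e4
  have e7 := congrArg Φ.d₀ e5
  simp only [map_add, map_sub, map_neg, map_zero, Derivation.leibniz, smul_eq_mul,
    derivation_ofNat, x0, y0, Derivation.map_one_eq_zero, Φ.d₀_p, Φ.d₀_q, Φ.d₀_d₁_m,
    Φ.d₀_d₀_r] at e6 e7
  have e8 := congrArg Φ.d₀ e6
  simp only [map_add, map_sub, map_zero, Derivation.leibniz, smul_eq_mul, derivation_ofNat, x0,
    Derivation.map_one_eq_zero, Φ.d₀_p, Φ.d₀_q, Φ.d₀_d₁_m, Φ.d₀_d₀_r] at e8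
  replace e1 := congrArg ε e1
  replace e2 := congrArg ε e2
  replace e3 := congrArg ε e3
  replace e4 := congrArg ε e4
  replace e5 := congrArg ε e5
  replace e6 := congrArg ε e6
  replace e7 := congrArg ε e7
  replace e8 := congrArg ε e8
  simp only [map_add, map_sub, map_mul, map_neg, map_zero, map_one, map_ofNat, hX, hY] at *
  constructor <;> linarith

/-- Three conditions on the jet for `a = (1 + 2 X) Y`, `b = 2 X + X² + Y²`. -/
theorem one_constraints (hX : ε X = 0) (hY : ε Y = 0) (x0 : Φ.d₀ X = 1) (x1 : Φ.d₁ X = 0)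
    (y0 : Φ.d₀ Y = 0) (y1 : Φ.d₁ Y = 1) (a1 : Φ.d₁ Φ.a = 1 + 2 * X) (a0 : Φ.d₀ Φ.a = 2 * Y)
    (b1 : Φ.d₁ Φ.b = 2 * Y) : ε Φ.p = 0 ∧ ε Φ.q = 0 ∧ ε Φ.t = 0 := by
  have e1 := Φ.t_r_relation
  have e2 := Φ.d₀_t
  have e3 := Φ.d₁_m
  have e4 := Φ.d₁_r
  simp only [a1, a0, b1, map_add, map_zero, Derivation.leibniz, smul_eq_mul, derivation_ofNat, x0,
    x1, Derivation.map_one_eq_zero] at e1 e2 e3 e4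
  have e5 := congrArg Φ.d₀ e1
  have e6 := congrArg Φ.d₁ e1
  have e7 := congrArg Φ.d₁ e3
  have e8 := congrArg Φ.d₁ e4
  simp only [map_add, map_sub, map_neg, map_zero, Derivation.leibniz, smul_eq_mul,
    derivation_ofNat, x0, x1, y1, Derivation.map_one_eq_zero, Φ.d₀_p, Φ.d₀_q, Φ.d₀_d₁_m,
    Φ.d₁_p, Φ.d₁_q, Φ.d₁_d₁_t] at e5 e6 e7 e8
  -- `f1` is free of `d₀ t`, `f2` of `d₁ d₁ m`, and `f5` of `d₁ d₁ r` and `d₁ d₀ r`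
  have f1 : 4 * Φ.t = 6 * (2 + 2 * X) * Φ.d₀ Φ.r + 4 * Y * Φ.d₁ Φ.t + 12 * Φ.r := by
    linear_combination e5 + 2 * e2
  have f2 : 2 * (1 + 2 * X) * (2 + 2 * X) * Φ.d₁ Φ.t =
      2 * (2 + 2 * X) * (2 + 2 * X) * Φ.d₁ Φ.r - 4 * Φ.q - 4 * Y * Φ.r := by
    linear_combination (2 + 2 * X) * e6 + 2 * e7
  have f3 := congrArg Φ.d₁ f1
  have f4 := congrArg Φ.d₁ f2
  simp only [map_add, map_sub, Derivation.leibniz, smul_eq_mul, derivation_ofNat, x1, y1,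
    Derivation.map_one_eq_zero, Φ.d₁_q, Φ.d₁_d₁_t] at f3 f4
  have f5 : 12 * Y * Φ.d₁ Φ.r = 24 * Φ.r + 12 * (2 + 2 * X) * Φ.d₀ Φ.r := by
    linear_combination -3 * f4 - 6 * (2 + 2 * X) * e8 - 2 * Y * f3
  have f6 := congrArg Φ.d₁ f5
  have f7 := congrArg Φ.d₀ f5
  simp only [map_add, Derivation.leibniz, smul_eq_mul, derivation_ofNat, x0, x1, y0, y1,
    Φ.d₀_d₀_r] at f6 f7
  replace e1 := congrArg ε e1
  replace e3 := congrArg ε e3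
  replace e4 := congrArg ε e4
  replace f1 := congrArg ε f1
  replace f2 := congrArg ε f2
  replace f3 := congrArg ε f3
  replace f5 := congrArg ε f5
  replace f6 := congrArg ε f6
  replace f7 := congrArg ε f7
  simp only [map_add, map_sub, map_mul, map_neg, map_zero, map_one, map_ofNat, hX, hY] at *
  refine ⟨?_, ?_, ?_⟩ <;> linarith

set_option maxHeartbeats 1000000 in
/-- The jet vanishes for `a = Y + 2 X Y + Y²`, `b = 2 X + X² + 2 X Y`. -/
theorem zero_constraints (hX : ε X = 0) (hY : ε Y = 0) (x0 : Φ.d₀ X = 1) (x1 : Φ.d₁ X = 0)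
    (y0 : Φ.d₀ Y = 0) (y1 : Φ.d₁ Y = 1) (a1 : Φ.d₁ Φ.a = 1 + 2 * X + 2 * Y)
    (a0 : Φ.d₀ Φ.a = 2 * Y) (b1 : Φ.d₁ Φ.b = 2 * X) :
    ε (Φ.m - Φ.l) = 0 ∧ ε Φ.p = 0 ∧ ε Φ.q = 0 ∧ ε Φ.t = 0 := by
  have e1 := Φ.t_r_relation
  have e2 := Φ.d₀_t
  have e3 := Φ.d₁_m
  have e4 := Φ.d₁_r
  have e5 := Φ.d₀_l
  simp only [a1, a0, b1, map_add, map_zero, Derivation.leibniz, smul_eq_mul, derivation_ofNat, x0,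
    x1, y0, y1, Derivation.map_one_eq_zero] at e1 e2 e3 e4 e5
  have g1 := congrArg Φ.d₀ e1
  have g2 := congrArg Φ.d₁ e1
  have g3 := congrArg Φ.d₀ e5
  have g4 := congrArg Φ.d₁ e3
  have g5 := congrArg Φ.d₀ e2
  have g6 := congrArg Φ.d₁ e4
  simp only [map_add, map_sub, map_neg, map_zero, Derivation.leibniz, smul_eq_mul,
    derivation_ofNat, x0, x1, y0, y1, Derivation.map_one_eq_zero, Φ.d₀_p, Φ.d₀_q, Φ.d₀_d₁_m,
    Φ.d₁_p, Φ.d₁_q, Φ.d₁_d₀_l, Φ.d₀_m, Φ.d₁_l, Φ.d₀_d₀_r, Φ.d₁_d₁_t] at g1 g2 g3 g4 g5 g6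
  -- `d₁ d₁ m` is eliminated before the next derivatives are taken
  have f : 2 * (2 + 2 * X + 2 * Y) * (4 * Φ.t - 4 * Φ.r + (1 + 2 * X + 2 * Y) * Φ.d₁ Φ.t
      - (2 + 2 * X + 2 * Y) * Φ.d₁ Φ.r) = 12 * Φ.p - 4 * X * Φ.r - 8 * Φ.d₁ Φ.m := by
    linear_combination 2 * g4 + (2 + 2 * X + 2 * Y) * g2
  replace f := congrArg Φ.d₁ f
  simp only [map_add, map_sub, Derivation.leibniz, smul_eq_mul, derivation_ofNat, x1, y1,
    Derivation.map_one_eq_zero, Φ.d₁_p, Φ.d₁_d₁_t] at f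
  have h1 := congrArg Φ.d₀ g1
  have h2 := congrArg Φ.d₁ g1
  have h3 := congrArg Φ.d₀ g2
  have h4 := congrArg Φ.d₁ g2
  have h5 := congrArg Φ.d₀ g3
  have h6 := congrArg Φ.d₁ g4
  have h7 := congrArg Φ.d₀ g6
  have h8 := congrArg Φ.d₁ g6
  have h9 := congrArg Φ.d₀ f
  have h0 := congrArg Φ.d₁ f
  simp only [map_add, map_sub, map_neg, map_zero, Derivation.leibniz, smul_eq_mul,
    derivation_ofNat, x0, x1, y0, y1, Derivation.map_one_eq_zero, Φ.d₀_p, Φ.d₀_q, Φ.d₀_d₁_m,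
    Φ.d₁_p, Φ.d₁_q, Φ.d₁_d₀_l, Φ.d₀_m, Φ.d₁_l, Φ.d₀_d₀_r, Φ.d₁_d₁_t, Φ.d₁_d₀_t, Φ.d₀_d₁_r,
    Φ.d₁_d₀_d₀_l, Φ.d₀_d₁_d₁_m, Φ.d₀_d₁_d₁_r] at h0 h1 h2 h3 h4 h5 h6 h7 h8 h9
  replace e1 := congrArg ε e1
  replace e2 := congrArg ε e2
  replace e3 := congrArg ε e3
  replace e4 := congrArg ε e4
  replace e5 := congrArg ε e5
  replace g1 := congrArg ε g1
  replace g2 := congrArg ε g2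
  replace g3 := congrArg ε g3
  replace g4 := congrArg ε g4
  replace g5 := congrArg ε g5
  replace g6 := congrArg ε g6
  replace h0 := congrArg ε h0
  replace h1 := congrArg ε h1
  replace h2 := congrArg ε h2
  replace h3 := congrArg ε h3
  replace h4 := congrArg ε h4
  replace h5 := congrArg ε h5
  replace h6 := congrArg ε h6
  replace h7 := congrArg ε h7
  replace h8 := congrArg ε h8
  replace h9 := congrArg ε h9
  clear f x0 x1 y0 y1 a1 a0 b1
  simp only [map_add, map_sub, map_mul, map_neg, map_zero, map_one, map_ofNat, hX, hY] at *
  refine ⟨?_, ?_, ?_, ?_⟩ <;> linarith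

/-- One condition on the jet for `a = Y E`, `b = E + X`, where `E` is the exponential of `X`. -/
theorem three_constraints (hY : ε Y = 0) (hE : ε E = 1)
    (y0 : Φ.d₀ Y = 0) (E0 : Φ.d₀ E = E) (E1 : Φ.d₁ E = 0)
    (a1 : Φ.d₁ Φ.a = E) (a0 : Φ.d₀ Φ.a = Y * E) (b1 : Φ.d₁ Φ.b = 0) :
    ε Φ.p + 2 * ε Φ.t = 0 := by
  have e1 := Φ.t_r_relation
  have e2 := Φ.d₀_t
  have e3 := Φ.d₁_m
  simp only [a1, a0, b1, E0, E1] at e1 e2 e3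
  have f1 := congrArg Φ.d₀ e1
  have f2 := congrArg Φ.d₀ e2
  have f3 := congrArg Φ.d₀ e3
  simp only [map_add, map_sub, map_neg, map_zero, Derivation.leibniz, smul_eq_mul,
    derivation_ofNat, E0, y0, Derivation.map_one_eq_zero, Φ.d₀_p, Φ.d₀_q, Φ.d₀_d₁_m,
    Φ.d₀_d₀_r] at f1 f2 f3
  have g1 := congrArg Φ.d₀ f1
  have g3 := congrArg Φ.d₀ f3
  simp only [map_add, map_sub, map_zero, Derivation.leibniz, smul_eq_mul, derivation_ofNat, E0,
    Derivation.map_one_eq_zero, Φ.d₀_p, Φ.d₀_q, Φ.d₀_d₁_m, Φ.d₀_d₀_r] at g1 g3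
  replace e1 := congrArg ε e1
  replace e2 := congrArg ε e2
  replace e3 := congrArg ε e3
  replace f1 := congrArg ε f1
  replace f2 := congrArg ε f2
  replace f3 := congrArg ε f3
  replace g1 := congrArg ε g1
  replace g3 := congrArg ε g3
  simp only [map_add, map_sub, map_mul, map_neg, map_zero, map_one, map_ofNat, hE, hY] at *
  linarith

end CentralFlux

/-! ### Germs of functions of one coordinate -/

section OneVariable

variable {x : Fin 3 → ℝ}

theorem tendsto_coord (k : Fin 3) : Tendsto (fun u : Fin 3 → ℝ => u k - x k) (𝓝 x) (𝓝 0) := by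
  rw [← sub_self (x k)]
  exact ((continuous_apply k).tendsto x).sub_const (x k)

theorem eventually_contDiffAt_comp_coord (k : Fin 3) {g : ℝ → ℝ}
    (hg : ∀ᶠ s in 𝓝 0, ContDiffAt ℝ ∞ g s) :
    ∀ᶠ u in 𝓝 x, ContDiffAt ℝ ∞ (fun u : Fin 3 → ℝ => g (u k - x k)) u := by
  filter_upwards [(tendsto_coord k).eventually hg] with u hu
  exact hu.comp u (f := fun u : Fin 3 → ℝ => u k - x k) (by fun_prop)

/-- The germ `g(uᵏ - xᵏ)` for a function `g` of one variable that is smooth near `0`. -/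
def compCoord (x : Fin 3 → ℝ) (k : Fin 3) (g : ℝ → ℝ) (hg : ∀ᶠ s in 𝓝 0, ContDiffAt ℝ ∞ g s) :
    SmoothGerm x :=
  mk (fun u => g (u k - x k)) (eventually_contDiffAt_comp_coord k hg)

theorem ev_compCoord (k : Fin 3) {g : ℝ → ℝ} (hg : ∀ᶠ s in 𝓝 0, ContDiffAt ℝ ∞ g s) :
    ev x (compCoord x k g hg) = g 0 :=
  congrArg g (sub_self _)

theorem pd_compCoord (i k : Fin 3) {g g' : ℝ → ℝ} (hg : ∀ᶠ s in 𝓝 0, ContDiffAt ℝ ∞ g s)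
    (hg' : ∀ᶠ s in 𝓝 0, ContDiffAt ℝ ∞ g' s) (h : ∀ᶠ s in 𝓝 0, HasDerivAt g (g' s) s) :
    pd x i (compCoord x k g hg) = if i = k then compCoord x k g' hg' else 0 := by
  have hd : ∀ᶠ u in 𝓝 x, fderiv ℝ (fun u : Fin 3 → ℝ => g (u k - x k)) u (Pi.single i 1) =
      if i = k then g' (u k - x k) else 0 := by
    filter_upwards [(tendsto_coord k).eventually h] with u hu
    have h1 : HasFDerivAt (fun u : Fin 3 → ℝ => u k - x k)
        (ContinuousLinearMap.proj (R := ℝ) (φ := fun _ : Fin 3 => ℝ) k) u :=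
      (hasFDerivAt_apply k u).sub_const _
    have h2 := (hu.comp_hasFDerivAt u h1).fderiv
    rw [Function.comp_def] at h2
    rw [h2]
    simp [Pi.single_apply, eq_comm]
  rw [compCoord, pd_mk]
  split_ifs with hik
  · exact mk_eq_mk.2 (hd.mono fun u hu => hu.trans (if_pos hik))
  · exact Subtype.ext (Germ.coe_eq.2 (hd.mono fun u hu => hu.trans (if_neg hik)))

variable (x)

/-- The germs of `exp(u⁰ - x⁰)` and its inverse. -/
theorem exists_exp : ∃ E Ei : SmoothGerm x, E * Ei = 1 ∧ ev x E = 1 ∧ ev x Ei = 1 ∧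
    pd x 0 E = E ∧ pd x 1 E = 0 ∧ pd x 2 E = 0 ∧
    pd x 0 Ei = -Ei ∧ pd x 1 Ei = 0 ∧ pd x 2 Ei = 0 := by
  have h1 : ∀ᶠ s in 𝓝 (0 : ℝ), ContDiffAt ℝ ∞ Real.exp s :=
    Eventually.of_forall fun s => Real.contDiff_exp.contDiffAt
  have h2 : ∀ᶠ s in 𝓝 (0 : ℝ), ContDiffAt ℝ ∞ (fun s => Real.exp (-s)) s :=
    Eventually.of_forall fun s => (Real.contDiff_exp.comp contDiff_neg).contDiffAt
  have h3 : ∀ᶠ s in 𝓝 (0 : ℝ), ContDiffAt ℝ ∞ (fun s => -Real.exp (-s)) s :=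
    Eventually.of_forall fun s => (Real.contDiff_exp.comp contDiff_neg).neg.contDiffAt
  have d1 : ∀ᶠ s in 𝓝 (0 : ℝ), HasDerivAt Real.exp (Real.exp s) s :=
    Eventually.of_forall Real.hasDerivAt_exp
  have d2 : ∀ᶠ s in 𝓝 (0 : ℝ), HasDerivAt (fun s => Real.exp (-s)) (-Real.exp (-s)) s :=
    Eventually.of_forall fun s => by simpa using (hasDerivAt_neg s).exp
  refine ⟨compCoord x 0 _ h1, compCoord x 0 _ h2, ?_, ?_, ?_, ?_, ?_, ?_, ?_, ?_, ?_⟩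
  · refine Subtype.ext (Germ.coe_eq.2 (Eventually.of_forall fun u => ?_))
    simp [← Real.exp_add]
  · simp [ev_compCoord]
  · simp [ev_compCoord]
  · rw [pd_compCoord 0 0 h1 h1 d1, if_pos rfl]
  · rw [pd_compCoord 1 0 h1 h1 d1, if_neg (by decide)]
  · rw [pd_compCoord 2 0 h1 h1 d1, if_neg (by decide)]
  · rw [pd_compCoord 0 0 h2 h3 d2, if_pos rfl]
    rfl
  · rw [pd_compCoord 1 0 h2 h3 d2, if_neg (by decide)]
  · rw [pd_compCoord 2 0 h2 h3 d2, if_neg (by decide)]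

/-- The germs of `log(1 + 2 X)` and `(1 + 2 X)⁻¹`, where `X = u⁰ - x⁰`. -/
theorem exists_log : ∃ L U : SmoothGerm x, (1 + 2 * coord x 0) * U = 1 ∧ ev x U = 1 ∧
    pd x 0 L = 2 * U ∧ pd x 1 L = 0 ∧ pd x 2 L = 0 ∧ pd x 1 U = 0 ∧ pd x 2 U = 0 := by
  have h0 : ∀ᶠ s in 𝓝 (0 : ℝ), 1 + 2 * s ≠ 0 := by
    have : ContinuousAt (fun s : ℝ => 1 + 2 * s) 0 := by fun_prop
    exact this.eventually_ne (by simp)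
  have h1 : ∀ᶠ s in 𝓝 (0 : ℝ), ContDiffAt ℝ ∞ (fun s => Real.log (1 + 2 * s)) s := by
    filter_upwards [h0] with s hs
    exact ContDiffAt.log (by fun_prop) hs
  have h2 : ∀ᶠ s in 𝓝 (0 : ℝ), ContDiffAt ℝ ∞ (fun s => (1 + 2 * s)⁻¹) s := by
    filter_upwards [h0] with s hs
    exact ContDiffAt.inv (by fun_prop) hs
  have h3 : ∀ᶠ s in 𝓝 (0 : ℝ), ContDiffAt ℝ ∞ (fun s => 2 * (1 + 2 * s)⁻¹) s := by
    filter_upwards [h2] with s hs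
    exact contDiffAt_const.mul hs
  have h4 : ∀ᶠ s in 𝓝 (0 : ℝ), ContDiffAt ℝ ∞ (fun s => -2 / (1 + 2 * s) ^ 2) s := by
    filter_upwards [h0] with s hs
    exact ContDiffAt.div contDiffAt_const (by fun_prop) (pow_ne_zero 2 hs)
  have d : ∀ s : ℝ, HasDerivAt (fun s => 1 + 2 * s) 2 s := fun s => by
    simpa using ((hasDerivAt_id s).const_mul 2).const_add 1
  have d1 : ∀ᶠ s in 𝓝 (0 : ℝ),
      HasDerivAt (fun s => Real.log (1 + 2 * s)) (2 * (1 + 2 * s)⁻¹) s := by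
    filter_upwards [h0] with s hs
    simpa [div_eq_mul_inv] using (d s).log hs
  have d2 : ∀ᶠ s in 𝓝 (0 : ℝ),
      HasDerivAt (fun s => (1 + 2 * s)⁻¹) (-2 / (1 + 2 * s) ^ 2) s := by
    filter_upwards [h0] with s hs
    exact (d s).inv hs
  refine ⟨compCoord x 0 _ h1, compCoord x 0 _ h2, ?_, ?_, ?_, ?_, ?_, ?_, ?_⟩
  · refine Subtype.ext (Germ.coe_eq.2 ?_)
    filter_upwards [(tendsto_coord 0).eventually h0] with u h
    exact mul_inv_cancel₀ h
  · simp [ev_compCoord]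
  · rw [pd_compCoord 0 0 h1 h3 d1, if_pos rfl]
    rfl
  · rw [pd_compCoord 1 0 h1 h3 d1, if_neg (by decide)]
  · rw [pd_compCoord 2 0 h1 h3 d1, if_neg (by decide)]
  · rw [pd_compCoord 1 0 h2 h4 d2, if_neg (by decide)]
  · rw [pd_compCoord 2 0 h2 h4 d2, if_neg (by decide)]

/-- The coordinate functions centred at `x`, with their derivatives. -/
theorem exists_coordinates : ∃ X Y Z : SmoothGerm x, X = coord x 0 ∧
    (pd x 0 X = 1 ∧ pd x 1 X = 0 ∧ pd x 2 X = 0) ∧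
    (pd x 0 Y = 0 ∧ pd x 1 Y = 1 ∧ pd x 2 Y = 0) ∧
    (pd x 0 Z = 0 ∧ pd x 1 Z = 0 ∧ pd x 2 Z = 1) ∧
    ev x X = 0 ∧ ev x Y = 0 ∧ ev x Z = 0 := by
  refine ⟨_, coord x 1, coord x 2, rfl, ?_⟩
  simp [pd_coord]

end OneVariable

/-! ### Examples of each dimension -/

section Examples

variable (x : Fin 3 → ℝ)

/-! Each flux is listed with its components and eigenvalues; `σ` selects the components of the jet
that are free. The jets of the listed fluxes are computed at the end of each proof. -/

/-- The fields `(1, 0, Y)` and `(0, 1, 2 X)` have fluxes with arbitrary jets. -/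
theorem exists_rank_eq_four : ∃ (R : Fin 2 → VField 3) (s : VField 3), SizeHypotheses x R s ∧
    Module.rank ℝ (FluxQuotient R x) = ((4 : ℕ) : Cardinal) := by
  obtain ⟨X, Y, Z, -, ⟨x0, x1, x2⟩, ⟨y0, y1, y2⟩, ⟨z0, z1, z2⟩, ex, ey, ez⟩ :=
    exists_coordinates x
  refine exists_rank_eq (a := Y) (b := 2 * X) y2 ?_ ?_ ?_ ?_ ?_ (id : Fin 4 → Fin 4)
    (fun Φ _ _ _ _ h => funext h)
    ![![X, 0, 2 * X * Y - Z], ![2 * X * X, Z - X * Y, 2 * X * X * Y],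
      ![4 * X * Y - 2 * Z, Y * Y, 2 * X * Y * Y],
      ![4 * X * X * Y - 2 * X * Z, Y * Z - X * Y * Y,
        2 * Z * Z - 6 * X * Y * Z + 6 * X * X * Y * Y]]
    ![![1, 0], ![4 * X, X], ![2 * Y, 2 * Y], ![6 * X * Y - 2 * Z, Z]] ?_ ?_
  · simp [derivation_ofNat, x2]
  · simp [derivation_ofNat, x0, y1]
    norm_num
  · simp [y1]
  · simp [y1]
  · simp [derivation_ofNat, y1, y0, x1]
  · intro j
    fin_cases j <;> refine isGermFlux_graphGerm ?_ ?_ ?_ ?_ ?_ ?_ <;>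
    · simp only [map_add, map_sub, map_zero, Derivation.leibniz, smul_eq_mul, derivation_ofNat,
        x0, x1, x2, y0, y1, y2, z0, z1, z2]
      ring
  · intro w
    have e1 : fluxJet (graphGerm Y (2 * X)) ![1, 0] = ![-1, 0, 0, 0] := by
      simp [fluxJet]
    have e2 : fluxJet (graphGerm Y (2 * X)) ![4 * X, X] = ![0, 0, 1, 0] := by
      simp [fluxJet, along_graphGerm, derivation_ofNat, x0, x1, x2, ex]
    have e3 : fluxJet (graphGerm Y (2 * X)) ![2 * Y, 2 * Y] = ![0, 2, 0, 0] := by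
      simp [fluxJet, along_graphGerm, derivation_ofNat, y0, y1, y2, map_ofNat (ev x)]
    have e4 : fluxJet (graphGerm Y (2 * X)) ![6 * X * Y - 2 * Z, Z] = ![0, 0, 0, 2] := by
      simp [fluxJet, along_graphGerm, derivation_ofNat, x0, x1, x2, y1, y2, z0, z1, z2, ex,
        ey, ez, map_ofNat (ev x)]
      norm_num
    refine ⟨![-w 0, w 2, w 1 / 2, w 3 / 2], fun j => ?_⟩
    rw [Fin.sum_univ_four]
    simp only [Matrix.cons_val, e1, e2, e3, e4, id]
    fin_cases j <;> simp

/-- The example `a = Y exp X`, `b = exp X + X`; the component `r₁(r₂(λ¹))` of the jet depends on the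
others. -/
theorem exists_rank_eq_three : ∃ (R : Fin 2 → VField 3) (s : VField 3), SizeHypotheses x R s ∧
    Module.rank ℝ (FluxQuotient R x) = ((3 : ℕ) : Cardinal) := by
  obtain ⟨X, Y, Z, -, ⟨x0, x1, x2⟩, ⟨y0, y1, y2⟩, ⟨z0, z1, z2⟩, ex, ey, ez⟩ :=
    exists_coordinates x
  -- `E = exp X` and `V = exp(-X)`
  obtain ⟨E, V, hEV, eE, eV, E0, E1, E2, V0, V1, V2⟩ := exists_exp x
  refine exists_rank_eq (a := Y * E) (b := E + X) ?_ ?_ ?_ ?_ ?_ ?_ ![0, 1, 2] ?_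
    ![![-V, 0, -Z + (E + X) * Y],
      ![X * X + 2 * X - 4 * (X + 1) * V, 2 * Z - 2 * Y * E, 2 * Y * (X * E + X * X)],
      ![-2 * (1 + V) * Z + 2 * Y * (E + X + 1 + X * V), 2 * Y * Y,
        2 * Y * E * Z - Z * Z + 2 * X * Y * Z
          + Y * Y * (2 * (E + X) - (E + X) * (E + X))]]
    ![![V, 0], ![2 * X + 2 + 4 * X * V, 2 * X],
      ![2 * Z * V + 2 * (1 - X) * V * Y, 4 * Y]] ?_ ?_
  · simp [y2, E2]
  · simp [x2, E2]
  · simp [x0, E0, E1, y1]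
  · simp [y1, E1, eE]
  · simp [y1, E1, eE]
  · simp [y1, y0, x1, E1, E0, eE, ey]
  · intro Φ h0 h1 ha hb h
    have hc := Φ.three_constraints (ev x) (Y := Y) (E := E) ey eE
      (by rw [h0, (along_graphGerm _ _ _).1]; simp [y0, y2])
      (by rw [h0, (along_graphGerm _ _ _).1]; simp [E0, E2])
      (by rw [h1, (along_graphGerm _ _ _).2]; simp [E1, E2])
      (by rw [h1, ha, (along_graphGerm _ _ _).2]; simp [E1, E2, y1, y2])
      (by rw [h0, ha, (along_graphGerm _ _ _).1]; simp [E0, E2, y0, y2])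
      (by rw [h1, hb, (along_graphGerm _ _ _).2]; simp [E1, E2, x1, x2])
    have j0 := h 0
    have j1 := h 1
    have j2 := h 2
    simp only [CentralFlux.jet, Matrix.cons_val] at j0 j1 j2
    rw [j1] at hc
    simp only [CentralFlux.jet, j0, j1, j2, show ev x Φ.t = 0 by linarith]
    ext i
    fin_cases i <;> rfl
  · intro j
    fin_cases j <;> refine isGermFlux_graphGerm ?_ ?_ ?_ ?_ ?_ ?_ <;>
      simp only [map_add, map_sub, map_neg, map_zero, Derivation.leibniz, smul_eq_mul,
        derivation_ofNat, x0, x1, x2, y0, y1, y2, z0, z1, z2, E0, E1, E2, V0, V1, V2,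
        Derivation.map_one_eq_zero]
    all_goals try ring1
    · linear_combination -Y * hEV
    · linear_combination (-4 * X * Y) * hEV
    · linear_combination (-2 * Y) * hEV
    · linear_combination -2 * hEV
    · linear_combination (-2 * Y * Z - 2 * Y * Y + 2 * X * Y * Y) * hEV
  · intro w
    have e1 : fluxJet (graphGerm (Y * E) (E + X)) ![V, 0] = ![-1, 0, 0, 0] := by
      simp [fluxJet, along_graphGerm, V1, V2, eV]
    have e2 : fluxJet (graphGerm (Y * E) (E + X)) ![2 * X + 2 + 4 * X * V, 2 * X] =
        ![-2, 0, 2, 0] := by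
      simp [fluxJet, along_graphGerm, derivation_ofNat, x0, x1, x2, ex, V1, V2,
        map_ofNat (ev x)]
    have e3 : (fluxJet (graphGerm (Y * E) (E + X))
          ![2 * Z * V + 2 * (1 - X) * V * Y, 4 * Y] 0 = 0 ∧
        fluxJet (graphGerm (Y * E) (E + X))
          ![2 * Z * V + 2 * (1 - X) * V * Y, 4 * Y] 1 = 4) ∧
        fluxJet (graphGerm (Y * E) (E + X))
          ![2 * Z * V + 2 * (1 - X) * V * Y, 4 * Y] 2 = 0 := by
      simp [fluxJet, along_graphGerm, derivation_ofNat, x1, x2, y0, y1, y2, z1, z2, ex,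
        ey, ez, V1, V2, eV, eE, map_ofNat (ev x)]
      norm_num
    refine ⟨![-w 0 - w 2, w 2 / 2, w 1 / 4], fun j => ?_⟩
    rw [Fin.sum_univ_three]
    fin_cases j <;> simp [e1, e2, e3]

/-- The example `a = (1 + 2 X) Y`, `b = 2 X + X²`. -/
theorem exists_rank_eq_two : ∃ (R : Fin 2 → VField 3) (s : VField 3), SizeHypotheses x R s ∧
    Module.rank ℝ (FluxQuotient R x) = ((2 : ℕ) : Cardinal) := by
  obtain ⟨X, Y, Z, hX, ⟨x0, x1, x2⟩, ⟨y0, y1, y2⟩, ⟨z0, z1, z2⟩, ex, ey, ez⟩ :=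
    exists_coordinates x
  -- `L = log(1 + 2 X)` and `U = (1 + 2 X)⁻¹`
  obtain ⟨L, U, hU, eU, L0, L1, L2, U1, U2⟩ := exists_log x
  rw [← hX] at hU
  refine exists_rank_eq (a := (1 + 2 * X) * Y) (b := 2 * X + X * X) ?_ ?_ ?_ ?_ ?_ ?_ ![0, 2] ?_
    ![![L, 0, -2 * Z + 2 * (2 * X + X * X) * Y],
      ![3 * X * X + 5 * X, 4 * Z - 4 * (X + X * X) * Y,
        -5 * Z + (4 * X * X * X + 13 * X * X + 10 * X) * Y]]
    ![![2 * U, 0], ![6 * X + 5, 4 * X]] ?_ ?_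
  · simp [derivation_ofNat, x2, y2]
  · simp [derivation_ofNat, x2]
  · simp [derivation_ofNat, x0, x1, y1]
    ring
  · simp [derivation_ofNat, x1, y1, ex]
  · simp [derivation_ofNat, x1, y1, ex]
  · simp [derivation_ofNat, x0, x1, y0, y1, ex, ey]
  · intro Φ h0 h1 ha hb h
    have hc := Φ.two_constraints (ev x) ex ey
      (by rw [h0, (along_graphGerm _ _ _).1]; simp [x0, x2])
      (by rw [h1, (along_graphGerm _ _ _).2]; simp [x1, x2])
      (by rw [h0, (along_graphGerm _ _ _).1]; simp [y0, y2])
      (by rw [h1, ha, (along_graphGerm _ _ _).2]; simp [derivation_ofNat, x1, x2, y1, y2])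
      (by rw [h0, ha, (along_graphGerm _ _ _).1]
          simp [derivation_ofNat, x0, x2, y0, y2, mul_comm])
      (by rw [h1, hb, (along_graphGerm _ _ _).2]; simp [derivation_ofNat, x1, x2])
    have j0 := h 0
    have j1 := h 1
    simp only [CentralFlux.jet, Matrix.cons_val] at j0 j1
    simp only [CentralFlux.jet, j0, j1, hc.1, hc.2]
    ext i
    fin_cases i <;> rfl
  · intro j
    fin_cases j <;> refine isGermFlux_graphGerm ?_ ?_ ?_ ?_ ?_ ?_ <;>
      simp only [map_add, map_sub, map_neg, map_zero, Derivation.leibniz, smul_eq_mul,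
        derivation_ofNat, x0, x1, x2, y0, y1, y2, z0, z1, z2, L0, L1, L2]
    all_goals try ring1
    linear_combination (-2 * Y) * hU
  · intro w
    have e1 : fluxJet (graphGerm ((1 + 2 * X) * Y) (2 * X + X * X)) ![2 * U, 0] =
        ![-2, 0, 0, 0] := by
      simp [fluxJet, along_graphGerm, derivation_ofNat, U1, U2, eU, map_ofNat (ev x)]
    have e2 : fluxJet (graphGerm ((1 + 2 * X) * Y) (2 * X + X * X)) ![6 * X + 5, 4 * X] =
        ![-5, 0, 4, 0] := by
      simp [fluxJet, along_graphGerm, derivation_ofNat, x0, x1, x2, ex, map_ofNat (ev x)]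
    refine ⟨![-(w 0 / 2) - 5 / 8 * w 1, w 1 / 4], fun j => ?_⟩
    rw [Fin.sum_univ_two]
    fin_cases j
    · simp [e1, e2]
      ring
    · simp [e1, e2]

/-- The example `a = (1 + 2 X) Y`, `b = 2 X + X² + Y²`; only the difference of the eigenvalues at
the base point is free. -/
theorem exists_rank_eq_one : ∃ (R : Fin 2 → VField 3) (s : VField 3), SizeHypotheses x R s ∧
    Module.rank ℝ (FluxQuotient R x) = ((1 : ℕ) : Cardinal) := by
  obtain ⟨X, Y, Z, hX, ⟨x0, x1, x2⟩, ⟨y0, y1, y2⟩, ⟨z0, z1, z2⟩, ex, ey, ez⟩ :=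
    exists_coordinates x
  -- `L = log(1 + 2 X)` and `U = (1 + 2 X)⁻¹`
  obtain ⟨L, U, hU, eU, L0, L1, L2, U1, U2⟩ := exists_log x
  rw [← hX] at hU
  refine exists_rank_eq (a := (1 + 2 * X) * Y) (b := 2 * X + X * X + Y * Y) ?_ ?_ ?_ ?_ ?_ ?_ ![0]
    ?_ ![![3 * L, 0, -6 * Z + 6 * (2 * X + X * X) * Y + 2 * Y * Y * Y]] ![![6 * U, 0]] ?_ ?_
  · simp [derivation_ofNat, x2, y2]
  · simp [derivation_ofNat, x2, y2]
  · simp [derivation_ofNat, x0, x1, y0, y1]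
    ring
  · simp [derivation_ofNat, x1, y1, ex]
  · simp [derivation_ofNat, x1, y1, ex]
  · simp [derivation_ofNat, x0, x1, y0, y1, ex, ey]
  · intro Φ h0 h1 ha hb h
    have hc := Φ.one_constraints (ev x) ex ey
      (by rw [h0, (along_graphGerm _ _ _).1]; simp [x0, x2])
      (by rw [h1, (along_graphGerm _ _ _).2]; simp [x1, x2])
      (by rw [h0, (along_graphGerm _ _ _).1]; simp [y0, y2])
      (by rw [h1, (along_graphGerm _ _ _).2]; simp [y1, y2])
      (by rw [h1, ha, (along_graphGerm _ _ _).2]; simp [derivation_ofNat, x1, x2, y1, y2])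
      (by rw [h0, ha, (along_graphGerm _ _ _).1]
          simp [derivation_ofNat, x0, x2, y0, y2, mul_comm])
      (by rw [h1, hb, (along_graphGerm _ _ _).2]
          simp [x1, x2, y1, y2, two_mul])
    have j0 := h 0
    simp only [CentralFlux.jet, Matrix.cons_val] at j0
    simp only [CentralFlux.jet, j0, hc.1, hc.2.1, hc.2.2]
    ext i
    fin_cases i <;> rfl
  · intro j
    fin_cases j
    refine isGermFlux_graphGerm ?_ ?_ ?_ ?_ ?_ ?_ <;>
      simp only [map_add, map_neg, map_zero, Derivation.leibniz, smul_eq_mul,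
        derivation_ofNat, x0, x1, x2, y0, y1, y2, z0, z1, z2, L0, L1, L2]
    all_goals try ring1
    linear_combination (-6 * Y) * hU
  · intro w
    have e1 : fluxJet (graphGerm ((1 + 2 * X) * Y) (2 * X + X * X + Y * Y)) ![6 * U, 0] =
        ![-6, 0, 0, 0] := by
      simp [fluxJet, along_graphGerm, derivation_ofNat, U1, U2, eU, map_ofNat (ev x)]
    refine ⟨![-(w 0 / 6)], fun j => ?_⟩
    fin_cases j
    simp [e1]

/-- For `a = Y + 2 X Y + Y²`, `b = 2 X + X² + 2 X Y` all fluxes are trivial. -/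
theorem exists_rank_eq_zero : ∃ (R : Fin 2 → VField 3) (s : VField 3), SizeHypotheses x R s ∧
    Module.rank ℝ (FluxQuotient R x) = ((0 : ℕ) : Cardinal) := by
  obtain ⟨X, Y, Z, -, ⟨x0, x1, x2⟩, ⟨y0, y1, y2⟩, -, ex, ey, -⟩ := exists_coordinates x
  refine exists_rank_eq (a := Y + 2 * X * Y + Y * Y) (b := 2 * X + X * X + 2 * X * Y)
    ?_ ?_ ?_ ?_ ?_ ?_ Fin.elim0 ?_ Fin.elim0 Fin.elim0 (fun j => j.elim0)
    fun _ => ⟨Fin.elim0, fun j => j.elim0⟩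
  · simp [derivation_ofNat, x2, y2]
  · simp [derivation_ofNat, x2, y2]
  · simp [derivation_ofNat, x0, x1, y0, y1]
    ring
  · simp [derivation_ofNat, x1, y1, ex, ey]
  · simp [derivation_ofNat, x1, y1, ex, ey]
  · simp [derivation_ofNat, x0, x1, y0, y1, ex, ey]
  · intro Φ h0 h1 ha hb _
    have hc := Φ.zero_constraints (ev x) ex ey
      (by rw [h0, (along_graphGerm _ _ _).1]; simp [x0, x2])
      (by rw [h1, (along_graphGerm _ _ _).2]; simp [x1, x2])
      (by rw [h0, (along_graphGerm _ _ _).1]; simp [y0, y2])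
      (by rw [h1, (along_graphGerm _ _ _).2]; simp [y1, y2])
      (by rw [h1, ha, (along_graphGerm _ _ _).2]
          simp [derivation_ofNat, x1, x2, y1, y2]
          ring)
      (by rw [h0, ha, (along_graphGerm _ _ _).1]
          simp [derivation_ofNat, x0, x2, y0, y2, mul_comm])
      (by rw [h1, hb, (along_graphGerm _ _ _).2]; simp [derivation_ofNat, x1, x2, y1, y2])
    simp only [CentralFlux.jet, hc.1, hc.2.1, hc.2.2.1, hc.2.2.2]
    ext i
    fin_cases i <;> rfl

end Examples

end FluxGeometry

theorem theorem6p2 (ubar : Fin 3 → ℝ) :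
    (∀ (R : Fin 2 → FluxGeometry.VField 3) (s : FluxGeometry.VField 3),
      FluxGeometry.SizeHypotheses ubar R s →
        0 ≤ Module.rank ℝ (FluxGeometry.FluxQuotient R ubar) ∧
          Module.rank ℝ (FluxGeometry.FluxQuotient R ubar) ≤ 4) ∧
    (∀ k : ℕ, k ≤ 4 →
      ∃ (R : Fin 2 → FluxGeometry.VField 3) (s : FluxGeometry.VField 3),
        FluxGeometry.SizeHypotheses ubar R s ∧
          Module.rank ℝ (FluxGeometry.FluxQuotient R ubar) = (k : Cardinal)) := by
  refine ⟨fun R s H => ⟨zero_le, H.rank_fluxQuotient_le⟩, fun k hk => ?_⟩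
  interval_cases k
  exacts [FluxGeometry.exists_rank_eq_zero ubar, FluxGeometry.exists_rank_eq_one ubar,
    FluxGeometry.exists_rank_eq_two ubar, FluxGeometry.exists_rank_eq_three ubar,
    FluxGeometry.exists_rank_eq_four ubar]
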